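/- Write $\|\mu\|$ for the total mass of a finite Borel measure $\mu\neq 0$ on $\mathbb{R}^d$ and $\tilde\mu=\mu/\|\mu\|$. We say that a kernel $k:\mathbb{R}^d\times\mathbb{R}^d\to\mathbb{R}$ is represented by constants $c_1,c_2\ge 0$ and nonzero finite Borel measures $\mu_+,\mu_-$ on $\mathbb{R}^d$ if for all $x,x'$ $$k(x,x')=c_1\int e^{\mathrm{i}\omega^\top(x-x')}\mu_+(d\omega)-c_2\int e^{\mathrm{i}\nu^\top(x-x')}\mu_-(d\nu).$$ Put $a=c_1\|\mu_+\|$ and $b=c_2\|\mu_-\|$. Given frequencies $\omega_1,\dots,\omega_s$ and $\nu_1,\dots,\nu_s$ in $\mathbb{R}^d$ ($s\ge 1$), the random feature approximation is $\tilde k(x,x')=\frac1s\sum_{i=1}^s\langle\varphi_i(x),\varphi_i(x')\rangle$, where $\langle\cdot,\cdot\rangle$ is the bilinear product on $\mathbb{C}^4$ and $$\varphi_i(x)=\big(\sqrt a\cos(\omega_i^\top x),\ \sqrt a\sin(\omega_i^\top x),\ \mathrm{i}\sqrt b\cos(\nu_i^\top x),\ \mathrm{i}\sqrt b\sin(\nu_i^\top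 x)\big).$$ Monte Carlo (MC) sampling draws $\omega_i\sim\tilde\mu_+$ and $\nu_i\sim\tilde\mu_-$, all independent. For rotation invariant $\mu_\pm$ and $d\ge1$, orthogonal Monte Carlo (OMC) sampling draws the families $(\omega_i)$ and $(\nu_i)$ independently of each other, each in the following way: the lengths are independent, distributed as the length of a sample from $\tilde\mu_+$ (resp. $\tilde\mu_-$); the directions of the first $d$ samples are the columns of a Haar distributed orthogonal $d\times d$ matrix, those of the next $d$ samples the columns of a second one, and so on; lengths and matrices are independent. The mean squared error is $\mathrm{MSE}[\tilde k(x,x')]=\mathbb{E}\,|k(x,x')-\tilde k(x,x')|^2$. (i) Approximation. Let $k$ be represented by $c_1,c_2,\mu_+,\mu_-$ as above, with the normalization $c_1\|\mu_+\|\le 1$ and $c_2\|\mu_-\|\le 1$, and suppose that $\sigma^2:=\mathbb{E}_{\omega\sim\tilde\mu_+}\|\omega\|_2^2+\mathbb{E}_{\nu\sim\tilde\mu_-}\|\nu\|_2^2<\infty$. Let $\mathcal S_R=\{x\in\mathbb{R}^d:\|x\|_2\le R\}$, $R\ge 0$. Then MC sampling satisfies, for every $s\ge1$ and $\epsilon>0$,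 $$\Pr\Big[\sup_{x,x'\in\mathcal S_R}|k(x,x')-\tilde k(x,x')|\ge\epsilon\Big]\le 66\Big(\frac{2\sigma R}{\epsilon}\Big)^2\exp\Big(-\frac{s\epsilon^2}{32(d+2)}\Big).$$ (ii) Variance reduction. Let $c_1,c_2\ge0$ and let $\varphi_+,\varphi_-:[0,\infty)\to\mathbb{R}$ be radial profiles such that, for every dimension $d$, there are nonzero finite Borel measures $\mu_{\pm}^{(d)}$ on $\mathbb{R}^d$ with $\int e^{\mathrm{i}\omega^\top z}\mu_\pm^{(d)}(d\omega)=\varphi_\pm(\|z\|_2)$ for all $z\in\mathbb{R}^d$ (so $\mu_\pm^{(d)}$ is rotation invariant). Let $k_d(x,x')=c_1\varphi_+(\|x-x'\|_2)-c_2\varphi_-(\|x-x'\|_2)$ on $\mathbb{R}^d$, which is represented by $c_1,c_2,\mu_+^{(d)},\mu_-^{(d)}$. Then for every $r\ge0$ there is $d_0$ such that for all $d\ge \max(d_0,1)$, all $s\ge1$ and all $x,x'\in\mathbb{R}^d$ with $\|x-x'\|_2=r$, $$\mathrm{MSE}[\tilde k^{\mathrm{OMC}}(x,x')]\le\mathrm{MSE}[\tilde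 k^{\mathrm{MC}}(x,x')].$$ -/

import Mathlib

open MeasureTheory Complex
open scoped ENNReal

noncomputable section

namespace SignedRF

/-- Euclidean space `ℝ^d`. -/
abbrev E (d : ℕ) : Type := EuclideanSpace ℝ (Fin d)

/-- The normalized measure `μ̃ = μ / ‖μ‖` of a finite nonzero measure `μ`, where `‖μ‖` is the
total mass of `μ`. -/
def normalized {d : ℕ} (μ : Measure (E d)) : Measure (E d) := (μ Set.univ)⁻¹ • μ

/-- The kernel `k` on `ℝ^d` is stationary and represented by the two nonnegative measures `μ₊, μ₋`
with weights `c₁, c₂`: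
`k(x, x') = c₁ ∫ exp(i ωᵀ(x - x')) μ₊(dω) - c₂ ∫ exp(i νᵀ(x - x')) μ₋(dν)`.
(`charFun μ t = ∫ exp(i ⟪ω, t⟫) μ(dω)`.) -/
def IsRepresentedBy {d : ℕ} (k : E d → E d → ℝ) (c₁ c₂ : ℝ) (μp μm : Measure (E d)) : Prop :=
  ∀ x x' : E d, (k x x' : ℂ) = c₁ * charFun μp (x - x') - c₂ * charFun μm (x - x')

/-- One block `φ_i(x) ∈ ℂ⁴` of the random feature map, for the frequencies `ω, ν` and the weights
`a = c₁ ‖μ₊‖`, `b = c₂ ‖μ₋‖`. -/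
def featureMap {d : ℕ} (a b : ℝ) (ω ν x : E d) : Fin 4 → ℂ :=
  ![((√a * Real.cos (inner ℝ ω x) : ℝ) : ℂ), ((√a * Real.sin (inner ℝ ω x) : ℝ) : ℂ),
    I * ((√b * Real.cos (inner ℝ ν x) : ℝ) : ℂ), I * ((√b * Real.sin (inner ℝ ν x) : ℝ) : ℂ)]

/-- The approximated kernel
`k̃(x, x') = (1/s) ∑ᵢ ⟨φ_i(x), φ_i(x')⟩`, where `⟨·,·⟩` is the bilinear
(not the sesquilinear) product on `ℂ⁴`. -/
def approxKernel {d s : ℕ} (a b : ℝ) (ω ν : Fin s → E d) (x x' : E d) : ℂ :=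
  (1 / (s : ℂ)) * ∑ i, featureMap a b (ω i) (ν i) x ⬝ᵥ featureMap a b (ω i) (ν i) x'

/-- The approximated kernel is real valued, with the expected explicit form. -/
theorem approxKernel_eq {d s : ℕ} {a b : ℝ} (ha : 0 ≤ a) (hb : 0 ≤ b) (ω ν : Fin s → E d)
    (x x' : E d) :
    approxKernel a b ω ν x x' =
      (((1 / (s : ℝ)) * ∑ i, (a * Real.cos (inner ℝ (ω i) (x - x')) -
        b * Real.cos (inner ℝ (ν i) (x - x'))) : ℝ) : ℂ) := by
  have h : ∀ i, featureMap a b (ω i) (ν i) x ⬝ᵥ featureMap a b (ω i) (ν i) x' =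
      ((a * Real.cos (inner ℝ (ω i) (x - x')) -
        b * Real.cos (inner ℝ (ν i) (x - x')) : ℝ) : ℂ) := by
    intro i
    have h1 : ((√a : ℝ) : ℂ) * ((√a : ℝ) : ℂ) = (a : ℂ) := by
      rw [← Complex.ofReal_mul, Real.mul_self_sqrt ha]
    have h2 : ((√b : ℝ) : ℂ) * ((√b : ℝ) : ℂ) = (b : ℂ) := by
      rw [← Complex.ofReal_mul, Real.mul_self_sqrt hb]
    simp only [featureMap, dotProduct, Fin.sum_univ_four, Matrix.cons_val, inner_sub_right,
      Real.cos_sub, Complex.ofReal_sub, Complex.ofReal_mul, Complex.ofReal_add]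
    rw [← h1, ← h2]
    linear_combination (((√b : ℝ) : ℂ) * ((√b : ℝ) : ℂ) *
      (((Real.cos (inner ℝ (ν i) x) : ℝ) : ℂ) * ((Real.cos (inner ℝ (ν i) x') : ℝ) : ℂ) +
      ((Real.sin (inner ℝ (ν i) x) : ℝ) : ℂ) * ((Real.sin (inner ℝ (ν i) x') : ℝ) : ℂ))) * I_mul_I
  simp only [approxKernel, h]
  push_cast
  rfl

/-- Plain Monte Carlo sampling: the law of `s` independent samples from `ρ`. -/
def mcLaw {d : ℕ} (s : ℕ) (ρ : Measure (E d)) : Measure (Fin s → E d) :=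
  Measure.pi fun _ => ρ

/-- The orthogonal group `O(d)`. -/
abbrev O (d : ℕ) : Type := Matrix.orthogonalGroup (Fin d) ℝ

instance instMeasurableSpaceO (d : ℕ) : MeasurableSpace (O d) := borel (O d)

instance instBorelSpaceO (d : ℕ) : BorelSpace (O d) := ⟨rfl⟩

instance instCompactSpaceO (d : ℕ) : CompactSpace (O d) := by
  refine isCompact_iff_compactSpace.mp (?_ : IsCompact
    ((Matrix.orthogonalGroup (Fin d) ℝ : Submonoid _) : Set (Matrix (Fin d) (Fin d) ℝ)))
  have hK : IsCompact (Set.pi Set.univ fun _ : Fin d =>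
      Set.pi Set.univ fun _ : Fin d => Set.Icc (-1 : ℝ) 1) :=
    isCompact_univ_pi fun _ => isCompact_univ_pi fun _ => isCompact_Icc
  refine IsCompact.of_isClosed_subset hK ?_ ?_
  · have : ((Matrix.orthogonalGroup (Fin d) ℝ : Submonoid _) : Set (Matrix (Fin d) (Fin d) ℝ)) =
        {A | A * star A = 1} := by
      ext A
      exact Matrix.mem_orthogonalGroup_iff (Fin d) ℝ
    refine this ▸ ?_
    exact isClosed_eq (continuous_id.mul continuous_star) continuous_const
  · intro A hA i _ j _
    have := entry_norm_bound_of_unitary hA i j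
    rw [Real.norm_eq_abs] at this
    exact abs_le.mp this

/-- The Haar probability measure on `O(d)`, i.e. the law of a uniformly random orthogonal
matrix. -/
def haarO (d : ℕ) : Measure (O d) := Measure.haarMeasure ⊤

instance instIsProbabilityMeasureHaarO (d : ℕ) : IsProbabilityMeasure (haarO d) :=
  ⟨Measure.haarMeasure_self⟩

/-- The `j`-th column of an orthogonal matrix, as a (unit) vector. -/
def column {d : ℕ} (Q : O d) (j : Fin d) : E d := WithLp.toLp 2 fun a => Q.1 a j

/-- Orthogonal Monte Carlo sampling: the law of `s` orthogonal samples from the rotation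
invariant probability measure `ρ` on `ℝ^d`, `d ≥ 1`. The lengths are independent copies of the
length of a `ρ`-distributed vector; the directions of the samples `0, …, d-1` are the columns of
a Haar distributed orthogonal matrix, those of the samples `d, …, 2d-1` are the columns of a second
one, and so on; lengths and matrices are all independent. (At most `s` matrices are used.) -/
def omcLaw {d : ℕ} [NeZero d] (s : ℕ) (ρ : Measure (E d)) : Measure (Fin s → E d) :=
  ((Measure.pi fun _ : Fin s => ρ.map fun w => ‖w‖).prod (Measure.pi fun _ : Fin s => haarO d)).map
    fun p i => p.1 i •
      column (p.2 ⟨(i : ℕ) / d, (Nat.div_le_self _ _).trans_lt i.isLt⟩) (Fin.ofNat d (i : ℕ))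

theorem measurable_column {d : ℕ} (j : Fin d) : Measurable fun Q : O d => column Q j := by
  refine Continuous.measurable ?_
  refine (PiLp.continuous_toLp 2 _).comp ?_
  exact continuous_pi fun a => (continuous_subtype_val.matrix_elem a j)

theorem measurable_omc {d : ℕ} [NeZero d] (s : ℕ) :
    Measurable fun (p : (Fin s → ℝ) × (Fin s → O d)) (i : Fin s) => p.1 i •
      column (p.2 ⟨(i : ℕ) / d, (Nat.div_le_self _ _).trans_lt i.isLt⟩) (Fin.ofNat d (i : ℕ)) := by
  refine measurable_pi_lambda _ fun i => ?_
  have h1 : Measurable fun p : (Fin s → ℝ) × (Fin s → O d) => p.1 i :=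
    (measurable_pi_apply i).comp measurable_fst
  have h2 : Measurable fun p : (Fin s → ℝ) × (Fin s → O d) =>
      column (p.2 ⟨(i : ℕ) / d, (Nat.div_le_self _ _).trans_lt i.isLt⟩) (Fin.ofNat d (i : ℕ)) :=
    (measurable_column _).comp
      ((measurable_pi_apply (X := fun _ : Fin s => O d) _).comp measurable_snd)
  exact h1.smul h2

theorem isProbabilityMeasure_omcLaw {d : ℕ} [NeZero d] (s : ℕ) (ρ : Measure (E d))
    [IsProbabilityMeasure ρ] : IsProbabilityMeasure (omcLaw s ρ) := by
  have : IsProbabilityMeasure (ρ.map fun w => ‖w‖) :=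
    Measure.isProbabilityMeasure_map measurable_norm.aemeasurable
  exact Measure.isProbabilityMeasure_map (measurable_omc s).aemeasurable

/-- The mean squared error `𝔼 |k(x, x') - k̃(x, x')|²`, when the frequencies `(ω_i)` have law `P`, the
frequencies `(ν_i)` have law `Q`, and the two families are independent. -/
def mse {d s : ℕ} (k : E d → E d → ℝ) (a b : ℝ) (P Q : Measure (Fin s → E d)) (x x' : E d) : ℝ :=
  ∫ p, ‖(k x x' : ℂ) - approxKernel a b p.1 p.2 x x'‖ ^ 2 ∂(P.prod Q)

/-- `σ² = 𝔼_{ω ∼ μ̃₊} ‖ω‖² + 𝔼_{ν ∼ μ̃₋} ‖ν‖²`. -/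
def sigmaSq {d : ℕ} (μp μm : Measure (E d)) : ℝ :=
  (∫ ω, ‖ω‖ ^ 2 ∂(normalized μp)) + ∫ ν, ‖ν‖ ^ 2 ∂(normalized μm)

end SignedRF

end

open MeasureTheory Complex
open scoped ENNReal

noncomputable section

/-! (i) The error depends only on `z = x - x'`, with `‖z‖ ≤ 2R`. At fixed `z` it averages bounded
independent terms, so Hoeffding gives the tail `2 exp(-s t² / 4)`
(`measureReal_abs_kernelError_ge_le`); its Lipschitz constant has second moment at most `8σ²`
(`measureReal_lipConst_ge_le`). If the error exceeds `ε` somewhere and the Lipschitz constant is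
below `ε / (2r)`, the error is at least `ε / 2` on a whole ball of radius `r`. The set of large
errors then has at least the volume of that ball, which Fubini and Markov make unlikely
(`measureReal_exists_forall_ball_le`); this plays the role of a covering argument. A suitable `r`
settles the case where `X = σ² R² / ε²` is not small. For small `X` the bound must be proportional
to `X` and still decay exponentially in `s`: there `1 - cos` is dominated by a truncated quadratic,
and Markov is applied to `exp S - 1` for its sum `S` over the samples
(`measureReal_uniformErrorEvent_le_of_small`).

(ii) The MSE splits into the second moments of the two empirical characteristic functions. Single
samples have the same cosine averages under both laws and different blocks are independent, so only
pairs within one orthogonal block matter; their correlation must be nonpositive. With `f` the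
characteristic function of the unit sphere and `θ` the normalized profile, this says `𝔼 f(r √(‖w₁‖²
+ ‖w₂‖²)) ≤ θ(r)²` (`exists_forall_integral_sphChar_le`).

In the variable `p = t² / d`, `f` becomes a function `Ψ` tending to `exp(-p / 2)`. The limit is
multiplicative, so the sign is decided at order `1 / d`. Bessel's equation turns into a first order
equation for `Ψ` with an explicit remainder, and a Grönwall argument bounds `2(d - 1)(Ψ(p+q) -
Ψ(p)Ψ(q))` by `-g(p) g(q) + o(1)` on bounded sets, `g(p) = p exp(-p / 2)`
(`scaledChar_add_sub_mul_le`), and by `12` everywhere.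

It remains to bound `𝔼 g` below uniformly in `d`. The profile is the same in all dimensions, and
`θ(r)` is within `O(1 / d)` of `𝔼 exp(-r² ‖ω‖² / (2d))`. Continuity of `θ` at `0` thus gives
tightness of `‖ω‖² / d`, and `θ(r) < 1` keeps its mass away from `0`. If `θ(r) ≥ 1` the claim is
trivial. -/

namespace SignedRF

/-! ### Rotations and Haar measure on the orthogonal group -/

section


/-- The action of an orthogonal matrix on `ℝ^d`. -/
def rotate {d : ℕ} (Q : O d) : E d →L[ℝ] E d := Matrix.toEuclideanCLM (𝕜 := ℝ) Q.1

theorem rotate_mul {d : ℕ} (P Q : O d) (w : E d) : rotate (P * Q) w = rotate P (rotate Q w) := by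
  simp [rotate]

theorem inner_rotate_rotate {d : ℕ} (Q : O d) (w z : E d) :
    inner ℝ (rotate Q w) (rotate Q z) = inner ℝ w z := by
  have h : ContinuousLinearMap.adjoint (rotate Q) * rotate Q = 1 := by
    rw [← ContinuousLinearMap.star_eq_adjoint, rotate, ← map_star, ← map_mul,
      (Unitary.mem_iff.1 Q.2).1, map_one]
  rw [← ContinuousLinearMap.adjoint_inner_right, ← mul_apply_eq_comp, h,
    one_apply_eq_self]

theorem norm_rotate {d : ℕ} (Q : O d) (w : E d) : ‖rotate Q w‖ = ‖w‖ := by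
  rw [norm_eq_sqrt_real_inner, inner_rotate_rotate, ← norm_eq_sqrt_real_inner]

theorem rotate_single {d : ℕ} (Q : O d) (j : Fin d) :
    rotate Q (EuclideanSpace.single j 1) = column Q j := by
  ext i
  change (Q.1.mulVec (Pi.single j 1)) i = Q.1 i j
  simp

/-- The reflection in the hyperplane orthogonal to `w - w'` swaps two vectors of equal length. -/
theorem exists_rotate_eq {d : ℕ} {w w' : E d} (h : ‖w‖ = ‖w'‖) : ∃ P : O d, rotate P w = w' := by
  let e : E d ≃ₗᵢ[ℝ] E d := (ℝ ∙ (w - w'))ᗮ.reflection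
  let u := Unitary.linearIsometryEquiv.symm e
  have hu : (u : E d →L[ℝ] E d) w = w' := by
    simpa [u, e] using Submodule.reflection_sub h
  obtain ⟨A, hA⟩ : ∃ A, Matrix.toEuclideanCLM (n := Fin d) (𝕜 := ℝ) A = (u : E d →L[ℝ] E d) :=
    EquivLike.surjective _ _
  have hA1 : star A * A = 1 := by
    apply EquivLike.injective (Matrix.toEuclideanCLM (n := Fin d) (𝕜 := ℝ))
    rw [map_mul, map_star, hA, map_one, (Unitary.mem_iff.1 u.2).1]
  exact ⟨⟨A, (Matrix.mem_orthogonalGroup_iff' (Fin d) ℝ).2 hA1⟩, by rw [rotate, hA, hu]⟩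

theorem continuous_rotate {d : ℕ} (w : E d) : Continuous fun Q : O d => rotate Q w := by
  refine (PiLp.continuous_toLp 2 _).comp ?_
  exact continuous_subtype_val.matrix_mulVec continuous_const

theorem continuous_inner_rotate {d : ℕ} (w z : E d) :
    Continuous fun Q : O d => inner ℝ (rotate Q w) z :=
  (continuous_rotate w).inner continuous_const

instance instIsHaarMeasureHaarO (d : ℕ) : (haarO d).IsHaarMeasure := by
  unfold haarO; infer_instance

/-- Compact groups are unimodular: a right translate is again a left Haar probability measure, and
that is unique. -/
instance instIsMulRightInvariantHaarO (d : ℕ) : (haarO d).IsMulRightInvariant where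
  map_mul_right_eq_self g := by
    have : IsProbabilityMeasure ((haarO d).map (· * g)) :=
      Measure.isProbabilityMeasure_map (measurable_mul_const g).aemeasurable
    exact Measure.isHaarMeasure_eq_of_isProbabilityMeasure _ _

/-- Changing `w` or `z` at fixed length is a rotation, which a right or left translation of Haar
measure absorbs. Hence spherical averages may be computed on coordinate vectors. -/
theorem integral_inner_rotate_congr {d : ℕ} (F : ℝ → ℝ) {w w' z z' : E d}
    (hw : ‖w‖ = ‖w'‖) (hz : ‖z‖ = ‖z'‖) :
    ∫ Q, F (inner ℝ (rotate Q w) z) ∂(haarO d) = ∫ Q, F (inner ℝ (rotate Q w') z') ∂(haarO d) := by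
  obtain ⟨P, rfl⟩ := exists_rotate_eq hw
  obtain ⟨R, rfl⟩ := exists_rotate_eq hz
  rw [← integral_mul_left_eq_self (fun Q => F (inner ℝ (rotate Q (rotate P w)) (rotate R z))) R,
    ← integral_mul_right_eq_self (fun Q => F (inner ℝ (rotate Q w) z)) P]
  simp only [rotate_mul, inner_rotate_rotate]

end

/-! ### The characteristic function of the sphere and Bessel's equation -/

section


section ParametricDerivatives

variable {Ω : Type*} [MeasurableSpace Ω] {μ : Measure Ω} [IsFiniteMeasure μ]

theorem integrable_of_abs_le {f : Ω → ℝ} (hf : Measurable f) {C : ℝ} (h : ∀ x, |f x| ≤ C) :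
    Integrable f μ :=
  Integrable.of_bound hf.aestronglyMeasurable C (Filter.Eventually.of_forall h)

/-- Dominated differentiation with bound `1`. The weight `W` lets it be iterated; the phase `A`
allows differentiation in a second direction, as the derivation of Bessel's equation needs. -/
theorem hasDerivAt_integral_mul_cos {W A B : Ω → ℝ} (hW : Measurable W) (hA : Measurable A)
    (hB : Measurable B) (hW1 : ∀ x, |W x| ≤ 1) (hB1 : ∀ x, |B x| ≤ 1) (h : ℝ) :
    HasDerivAt (fun h => ∫ x, W x * Real.cos (A x + h * B x) ∂μ)
      (∫ x, -(W x * B x * Real.sin (A x + h * B x)) ∂μ) h := by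
  refine (hasDerivAt_integral_of_dominated_loc_of_deriv_le (bound := fun _ => 1)
    (F' := fun h x => -(W x * B x * Real.sin (A x + h * B x)))
    Filter.univ_mem (Filter.Eventually.of_forall fun h => ?_) ?_ ?_
    (Filter.Eventually.of_forall fun x h _ => ?_) (integrable_const 1)
    (Filter.Eventually.of_forall fun x h _ => ?_)).2
  · exact Measurable.aestronglyMeasurable (by fun_prop)
  · refine integrable_of_abs_le (C := 1) (by fun_prop) fun x => ?_
    rw [abs_mul]
    exact mul_le_one₀ (hW1 x) (abs_nonneg _) (Real.abs_cos_le_one _)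
  · exact Measurable.aestronglyMeasurable (by fun_prop)
  · rw [Real.norm_eq_abs, abs_neg, abs_mul, abs_mul]
    exact mul_le_one₀ (mul_le_one₀ (hW1 x) (abs_nonneg _) (hB1 x)) (abs_nonneg _)
      (Real.abs_sin_le_one _)
  · have := (((hasDerivAt_id h).mul_const (B x)).const_add (A x)).cos.const_mul (W x)
    convert! this using 1
    simp; ring

theorem hasDerivAt_integral_mul_sin {W A B : Ω → ℝ} (hW : Measurable W) (hA : Measurable A)
    (hB : Measurable B) (hW1 : ∀ x, |W x| ≤ 1) (hB1 : ∀ x, |B x| ≤ 1) (h : ℝ) :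
    HasDerivAt (fun h => ∫ x, W x * Real.sin (A x + h * B x) ∂μ)
      (∫ x, W x * B x * Real.cos (A x + h * B x) ∂μ) h := by
  have := hasDerivAt_integral_mul_cos (μ := μ) hW (hA.sub_const (Real.pi / 2)) hB hW1 hB1 h
  simpa only [sub_add_eq_add_sub, Real.cos_sub_pi_div_two, Real.sin_sub_pi_div_two, mul_neg, neg_neg]
    using this

end ParametricDerivatives

variable {d : ℕ} [NeZero d]

/-- The entry in row `0` and column `j` of an orthogonal matrix. -/
def entry (j : Fin d) (Q : O d) : ℝ := Q.1 0 j

theorem measurable_entry (j : Fin d) : Measurable (entry j) :=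
  (continuous_subtype_val.matrix_elem 0 j).measurable

theorem inner_rotate_single (Q : O d) (j : Fin d) :
    inner ℝ (rotate Q (EuclideanSpace.single j 1)) (EuclideanSpace.single 0 1) = entry j Q := by
  rw [rotate_single, real_inner_comm, EuclideanSpace.inner_single_left]
  simp [column, entry]

theorem sum_entry_sq (Q : O d) : ∑ j, entry j Q ^ 2 = 1 := by
  have h := congrFun (congrFun ((Matrix.mem_orthogonalGroup_iff (Fin d) ℝ).1 Q.2) 0) 0
  simpa [Matrix.mul_apply, Matrix.star_apply, entry, sq] using h

theorem abs_entry_le (j : Fin d) (Q : O d) : |entry j Q| ≤ 1 := by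
  rw [← sq_le_one_iff_abs_le_one, ← sum_entry_sq Q]
  exact Finset.single_le_sum (f := fun j => entry j Q ^ 2) (fun _ _ => sq_nonneg _)
    (Finset.mem_univ j)

/-- By symmetry all `d` entries of a row have the same second moment, and their squares sum to `1`.
This is the source of every factor `1 / d` below. -/
theorem integral_entry_sq (j : Fin d) : ∫ Q, entry j Q ^ 2 ∂(haarO d) = 1 / d := by
  have h0 : ∀ i : Fin d, ∫ Q, entry i Q ^ 2 ∂(haarO d) = ∫ Q, entry j Q ^ 2 ∂(haarO d) := by
    intro i
    have := integral_inner_rotate_congr (fun x => x ^ 2)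
      (w := EuclideanSpace.single i (1 : ℝ)) (w' := EuclideanSpace.single j (1 : ℝ))
      (z := EuclideanSpace.single (0 : Fin d) (1 : ℝ)) (by simp) rfl
    simpa only [inner_rotate_single] using this
  have h1 : ∑ i : Fin d, ∫ Q, entry i Q ^ 2 ∂(haarO d) = 1 := by
    rw [← integral_finsetSum]
    · simp [sum_entry_sq]
    · intro i _
      refine integrable_of_abs_le (C := 1) ((measurable_entry i).pow_const 2) fun Q => ?_
      rw [abs_pow]
      exact pow_le_one₀ (abs_nonneg _) (abs_entry_le i Q)
  have hd : (d : ℝ) ≠ 0 := Nat.cast_ne_zero.2 (NeZero.ne d)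
  simp only [h0, Finset.sum_const, Finset.card_univ, Fintype.card_fin, nsmul_eq_mul] at h1
  field_simp
  linarith

variable (d) in
/-- The characteristic function of the uniform distribution on the unit sphere of `ℝ^d`, as a
function of the norm. -/
def sphChar (t : ℝ) : ℝ := ∫ Q : O d, Real.cos (t * entry 0 Q) ∂(haarO d)

variable (d) in
/-- The derivative of `sphChar`. -/
def sphChar₁ (t : ℝ) : ℝ := ∫ Q : O d, -(entry 0 Q * Real.sin (t * entry 0 Q)) ∂(haarO d)

variable (d) in
/-- The second derivative of `sphChar`. -/
def sphChar₂ (t : ℝ) : ℝ := ∫ Q : O d, -(entry 0 Q ^ 2 * Real.cos (t * entry 0 Q)) ∂(haarO d)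

variable (d) in
/-- The third derivative of `sphChar`. -/
def sphChar₃ (t : ℝ) : ℝ := ∫ Q : O d, entry 0 Q ^ 3 * Real.sin (t * entry 0 Q) ∂(haarO d)

theorem hasDerivAt_sphChar (t : ℝ) : HasDerivAt (sphChar d) (sphChar₁ d t) t := by
  have := hasDerivAt_integral_mul_cos (μ := haarO d) (W := fun _ => 1) (A := fun _ => 0)
    measurable_const measurable_const (measurable_entry 0) (by simp) (abs_entry_le 0) t
  simp only [one_mul, zero_add] at this
  exact this

theorem hasDerivAt_sphChar₁ (t : ℝ) : HasDerivAt (sphChar₁ d) (sphChar₂ d t) t := by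
  have := (hasDerivAt_integral_mul_sin (μ := haarO d) (A := fun _ => 0) (measurable_entry 0)
    measurable_const (measurable_entry 0) (abs_entry_le 0) (abs_entry_le 0) t).neg
  simp only [zero_add, ← integral_neg, ← sq] at this
  convert! this using 1
  ext t
  exact integral_neg _

theorem hasDerivAt_sphChar₂ (t : ℝ) : HasDerivAt (sphChar₂ d) (sphChar₃ d t) t := by
  have := (hasDerivAt_integral_mul_cos (μ := haarO d) (W := fun Q => entry 0 Q ^ 2)
    (A := fun _ => 0) ((measurable_entry 0).pow_const 2)
    measurable_const (measurable_entry 0) (fun Q => by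
      rw [abs_pow]; exact pow_le_one₀ (abs_nonneg _) (abs_entry_le 0 Q)) (abs_entry_le 0) t).neg
  simp only [zero_add, ← integral_neg, ← pow_succ, neg_neg] at this
  convert! this using 1
  ext t
  exact integral_neg _

theorem sphChar_zero : sphChar d 0 = 1 := by simp [sphChar]

theorem continuous_sphChar : Continuous (sphChar d) :=
  continuous_iff_continuousAt.2 fun t => (hasDerivAt_sphChar t).continuousAt

theorem abs_sphChar_le (t : ℝ) : |sphChar d t| ≤ 1 := by
  have := norm_integral_le_of_norm_le_const (μ := haarO d) (C := 1)
    (f := fun Q => Real.cos (t * entry 0 Q)) (Filter.Eventually.of_forall fun Q => Real.abs_cos_le_one (t * entry 0 Q))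
  simpa [sphChar] using this

theorem integrable_entry_sq : Integrable (fun Q => entry (0 : Fin d) Q ^ 2) (haarO d) :=
  integrable_of_abs_le (C := 1) ((measurable_entry 0).pow_const 2) fun Q => by
    rw [abs_pow]; exact pow_le_one₀ (abs_nonneg _) (abs_entry_le 0 Q)

theorem abs_sphChar₂_le (t : ℝ) : |sphChar₂ d t| ≤ 1 / d := by
  rw [← integral_entry_sq (0 : Fin d), sphChar₂, ← Real.norm_eq_abs]
  refine norm_integral_le_of_norm_le (integrable_entry_sq (d := d)) (Filter.Eventually.of_forall fun Q => ?_)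
  rw [norm_neg, norm_mul, Real.norm_eq_abs, Real.norm_eq_abs, abs_pow, sq_abs]
  exact mul_le_of_le_one_right (sq_nonneg _) (Real.abs_cos_le_one _)

theorem abs_sphChar₃_le (t : ℝ) : |sphChar₃ d t| ≤ 1 / d := by
  rw [← integral_entry_sq (0 : Fin d), sphChar₃, ← Real.norm_eq_abs]
  refine norm_integral_le_of_norm_le (integrable_entry_sq (d := d)) (Filter.Eventually.of_forall fun Q => ?_)
  rw [norm_mul, Real.norm_eq_abs, Real.norm_eq_abs, pow_succ, abs_mul, abs_pow, sq_abs, mul_assoc]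
  exact mul_le_of_le_one_right (sq_nonneg _)
    (mul_le_one₀ (abs_entry_le 0 Q) (abs_nonneg _) (Real.abs_sin_le_one _))

/-- The spherical average of a plane wave. -/
theorem integral_cos_inner_rotate (w z : E d) :
    ∫ Q, Real.cos (inner ℝ (rotate Q w) z) ∂(haarO d) = sphChar d (‖w‖ * ‖z‖) := by
  rw [integral_inner_rotate_congr Real.cos (w' := EuclideanSpace.single 0 ‖w‖)
    (z' := EuclideanSpace.single 0 ‖z‖) (by simp) (by simp)]
  have h : ∀ c : ℝ, EuclideanSpace.single (0 : Fin d) c = c • EuclideanSpace.single 0 1 := by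
    intro c; ext i; simp
  refine integral_congr_ae (Filter.Eventually.of_forall fun Q => ?_)
  dsimp only
  rw [h ‖w‖, h ‖z‖, map_smul, real_inner_smul_left, real_inner_smul_right, inner_rotate_single]
  ring_nf

theorem norm_smul_single_add {n : ℕ} {i j : Fin n} (hij : i ≠ j) (s h : ℝ) :
    ‖s • EuclideanSpace.single i (1 : ℝ) + h • EuclideanSpace.single j (1 : ℝ)‖
      = √(s ^ 2 + h ^ 2) := by
  rw [norm_eq_sqrt_real_inner]
  congr 1
  simp only [inner_add_left, inner_add_right, real_inner_smul_left, real_inner_smul_right,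
    EuclideanSpace.inner_single_left]
  simp [hij, hij.symm]
  ring

/-- The phase is the inner product of the rotated vector `s e₀ + h eⱼ` with `e₀`, so only the length
`√(s² + h²)` matters. -/
theorem integral_cos_entry_add {j : Fin d} (hj : j ≠ 0) (s h : ℝ) :
    ∫ Q, Real.cos (s * entry 0 Q + h * entry j Q) ∂(haarO d) = sphChar d √(s ^ 2 + h ^ 2) := by
  have := integral_cos_inner_rotate
    (s • EuclideanSpace.single (0 : Fin d) (1 : ℝ) + h • EuclideanSpace.single j (1 : ℝ))
    (EuclideanSpace.single (0 : Fin d) (1 : ℝ))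
  rw [norm_smul_single_add hj.symm] at this
  simpa [inner_add_left, real_inner_smul_left, inner_rotate_single] using this

/-- Differentiate `integral_cos_entry_add` twice in `h` at `h = 0`: the radial function on the right
has transversal second derivative `f'(s) / s`. -/
theorem integral_entry_sq_mul_cos {j : Fin d} (hj : j ≠ 0) {s : ℝ} (hs : 0 < s) :
    ∫ Q, entry j Q ^ 2 * Real.cos (s * entry 0 Q) ∂(haarO d) = -(sphChar₁ d s / s) := by
  have hpos : ∀ h : ℝ, 0 < s ^ 2 + h ^ 2 := fun h => by positivity
  have hsqrt : ∀ h : ℝ, HasDerivAt (fun h => √(s ^ 2 + h ^ 2)) (h / √(s ^ 2 + h ^ 2)) h := by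
    intro h
    have := (((hasDerivAt_id h).pow 2).const_add (s ^ 2)).sqrt (hpos h).ne'
    convert! this using 1
    simp
    rw [mul_div_mul_left _ _ two_ne_zero]
  have key : ∀ h : ℝ, ∫ Q, entry j Q * Real.sin (s * entry 0 Q + h * entry j Q) ∂(haarO d)
      = -(h * (sphChar₁ d √(s ^ 2 + h ^ 2) / √(s ^ 2 + h ^ 2))) := by
    intro h
    have h1 := hasDerivAt_integral_mul_cos (μ := haarO d) (W := fun _ => 1)
      (A := fun Q => s * entry 0 Q) measurable_const ((measurable_entry 0).const_mul s)
      (measurable_entry j) (by simp) (abs_entry_le j) h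
    have h2 := (hasDerivAt_sphChar (d := d) √(s ^ 2 + h ^ 2)).comp h (hsqrt h)
    simp only [one_mul, integral_cos_entry_add hj, integral_neg] at h1
    have := h1.unique h2
    rw [← neg_eq_iff_eq_neg, this]
    ring
  have h3 := hasDerivAt_integral_mul_sin (μ := haarO d)
      (A := fun Q => s * entry 0 Q) (measurable_entry j) ((measurable_entry 0).const_mul s)
      (measurable_entry j) (abs_entry_le j) (abs_entry_le j) 0
  simp only [key] at h3
  have hne : √(s ^ 2 + (0 : ℝ) ^ 2) ≠ 0 := (Real.sqrt_pos.2 (hpos 0)).ne'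
  have h4 := ((hasDerivAt_id (0 : ℝ)).mul
    (((hasDerivAt_sphChar₁ (d := d) _).comp 0 (hsqrt 0)).div (hsqrt 0) hne)).neg
  have h5 := h3.unique h4
  simpa [← sq, Real.sqrt_sq hs.le] using h5

/-- Bessel's differential equation for the spherical characteristic function. -/
theorem mul_sphChar_add_sphChar₂ {s : ℝ} (hs : 0 < s) :
    s * (sphChar d s + sphChar₂ d s) = -((d - 1) * sphChar₁ d s) := by
  have hint : ∀ j : Fin d,
      Integrable (fun Q => entry j Q ^ 2 * Real.cos (s * entry 0 Q)) (haarO d) := by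
    intro j
    have hj := measurable_entry j
    have h0 := measurable_entry (0 : Fin d)
    refine integrable_of_abs_le (C := 1) (by fun_prop) fun Q => ?_
    rw [abs_mul, abs_pow]
    exact mul_le_one₀ (pow_le_one₀ (abs_nonneg _) (abs_entry_le j Q)) (abs_nonneg _)
      (Real.abs_cos_le_one _)
  -- Insert `1 = ∑ⱼ Q₀ⱼ²`: the term `j = 0` is `-f''`, the other `d - 1` terms are `-f' / s` each.
  have h1 : sphChar d s = ∑ j : Fin d, ∫ Q, entry j Q ^ 2 * Real.cos (s * entry 0 Q) ∂(haarO d) := by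
    rw [← integral_finsetSum _ fun j _ => hint j]
    simp only [← Finset.sum_mul, sum_entry_sq, one_mul]
    rfl
  have h2 : sphChar₂ d s = -∫ Q, entry (0 : Fin d) Q ^ 2 * Real.cos (s * entry 0 Q) ∂(haarO d) :=
    integral_neg _
  have h3 : ∀ j ∈ Finset.univ.erase (0 : Fin d),
      ∫ Q, entry j Q ^ 2 * Real.cos (s * entry 0 Q) ∂(haarO d) = -(sphChar₁ d s / s) :=
    fun j hj => integral_entry_sq_mul_cos (Finset.ne_of_mem_erase hj) hs
  rw [← Finset.add_sum_erase _ _ (Finset.mem_univ (0 : Fin d)), Finset.sum_congr rfl h3] at h1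
  simp only [Finset.sum_const, Finset.card_erase_of_mem (Finset.mem_univ _), Finset.card_univ,
    Fintype.card_fin, nsmul_eq_mul, Nat.cast_pred (NeZero.pos d)] at h1
  rw [h1, h2]
  field_simp
  ring

/-- The derivative of Bessel's equation; it expresses `f + d f''`, the remainder `scaledRem` below,
through `f'` and `f'''`. -/
theorem deriv_mul_sphChar_add_sphChar₂ {s : ℝ} (hs : 0 < s) :
    sphChar d s + sphChar₂ d s + s * (sphChar₁ d s + sphChar₃ d s) = -((d - 1) * sphChar₂ d s) := by
  have h1 := (hasDerivAt_id s).mul ((hasDerivAt_sphChar (d := d) s).add (hasDerivAt_sphChar₂ (d := d) s))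
  have h2 := ((hasDerivAt_sphChar₁ (d := d) s).const_mul ((d : ℝ) - 1)).neg
  have h3 : (-fun s => (d - 1) * sphChar₁ d s) =ᶠ[nhds s] id * (sphChar d + sphChar₂ d) := by
    filter_upwards [lt_mem_nhds hs] with x hx
    exact (mul_sphChar_add_sphChar₂ hx).symm
  simpa using (h1.congr_of_eventuallyEq h3).unique h2

end

/-! ### High dimensional asymptotics of the spherical characteristic function -/

section


/-- A Grönwall estimate for `y' = -y / 2 + O(ε)`, `y 0 = 0`. -/
theorem abs_le_of_abs_deriv_add_half_le {y y' : ℝ → ℝ} {ε : ℝ} (hε : 0 ≤ ε)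
    (hc : Continuous y) (h0 : y 0 = 0) {p : ℝ} (hp : 0 ≤ p)
    (hd : ∀ x, 0 < x → x < p → HasDerivAt y (y' x) x)
    (hb : ∀ x, 0 < x → x < p → |y' x + y x / 2| ≤ ε) : |y p| ≤ 2 * ε := by
  have main : ∀ z z' : ℝ → ℝ, Continuous z → z 0 = 0 →
      (∀ x, 0 < x → x < p → HasDerivAt z (z' x) x) →
      (∀ x, 0 < x → x < p → z' x + z x / 2 ≤ ε) → z p ≤ 2 * ε := by
    intro z z' hz hz0 hzd hzb
    -- Integrating factor `exp(x / 2)`; the shift `2 ε` is the equilibrium of `z' = -z / 2 + ε`. The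
    -- two-sided bound applies this to `y` and `-y`.
    have hanti : AntitoneOn (fun x => Real.exp (x / 2) * (z x - 2 * ε)) (Set.Icc 0 p) := by
      refine antitoneOn_of_hasDerivWithinAt_nonpos (convex_Icc 0 p)
        (f' := fun x => Real.exp (x / 2) * (z' x + z x / 2 - ε)) (by fun_prop) ?_ ?_
      · intro x hx
        rw [interior_Icc] at hx
        have h1 := (((hasDerivAt_id x).div_const 2).exp).mul ((hzd x hx.1 hx.2).sub_const (2 * ε))
        convert! h1.hasDerivWithinAt using 1
        simp
        ring
      · intro x hx
        rw [interior_Icc] at hx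
        exact mul_nonpos_of_nonneg_of_nonpos (Real.exp_pos _).le
          (by linarith [hzb x hx.1 hx.2])
    have h1 := hanti (Set.left_mem_Icc.2 hp) (Set.right_mem_Icc.2 hp) hp
    simp only [hz0, zero_div, Real.exp_zero, one_mul, zero_sub] at h1
    by_contra hcon
    push Not at hcon
    have : 0 < Real.exp (p / 2) * (z p - 2 * ε) := mul_pos (Real.exp_pos _) (by linarith)
    linarith
  rw [abs_le]
  constructor
  · have := main (fun x => -y x) (fun x => -y' x) hc.neg (by simp [h0])
      (fun x h1 h2 => (hd x h1 h2).neg)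
      (fun x h1 h2 => by have := (abs_le.1 (hb x h1 h2)).1; linarith)
    linarith
  · exact main y y' hc h0 hd fun x h1 h2 => (abs_le.1 (hb x h1 h2)).2

variable (d : ℕ) [NeZero d]

/-- The spherical characteristic function in the variable `p = t² / d`, in which it converges to
`exp (-p / 2)` as `d → ∞`. -/
def scaledChar (p : ℝ) : ℝ := sphChar d √(d * p)

/-- `scaledChar d` solves `y' = -y / 2 - scaledRem d / (2 (d - 1))`. -/
def scaledRem (p : ℝ) : ℝ := sphChar d √(d * p) + d * sphChar₂ d √(d * p)

theorem continuous_scaledChar : Continuous (scaledChar d) :=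
  continuous_sphChar.comp (by fun_prop)

theorem scaledChar_zero : scaledChar d 0 = 1 := by simp [scaledChar, sphChar_zero]

theorem abs_scaledChar_le (p : ℝ) : |scaledChar d p| ≤ 1 := abs_sphChar_le _

theorem abs_scaledRem_le (p : ℝ) : |scaledRem d p| ≤ 2 := by
  have hd : (0 : ℝ) < d := Nat.cast_pos.2 (NeZero.pos d)
  have h1 := abs_sphChar_le (d := d) √(d * p)
  have h2 := abs_sphChar₂_le (d := d) √(d * p)
  rw [le_div_iff₀ hd] at h2
  calc |scaledRem d p| ≤ |sphChar d √(d * p)| + |d * sphChar₂ d √(d * p)| := abs_add_le _ _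
    _ = |sphChar d √(d * p)| + |sphChar₂ d √(d * p)| * d := by
        rw [abs_mul, abs_of_pos hd]; ring
    _ ≤ 2 := by linarith

variable {d}

/-- Chain rule, with `f'` eliminated by Bessel's equation: this cancels the factor `1 / √(d p)` and
makes the equation first order. -/
theorem hasDerivAt_scaledChar (hd : 2 ≤ d) {p : ℝ} (hp : 0 < p) :
    HasDerivAt (scaledChar d)
      (-(scaledChar d p) / 2 - scaledRem d p / (2 * (d - 1))) p := by
  have hd' : (2 : ℝ) ≤ d := by exact_mod_cast hd
  have hdp : 0 < d * p := by positivity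
  have ht : 0 < √(d * p) := Real.sqrt_pos.2 hdp
  have h1 := (hasDerivAt_sphChar (d := d) √(d * p)).comp p
    (((hasDerivAt_id p).const_mul (d : ℝ)).sqrt hdp.ne')
  convert! h1 using 1
  have h2 := mul_sphChar_add_sphChar₂ (d := d) ht
  have hd1 : (d : ℝ) - 1 ≠ 0 := by linarith
  have h3 : sphChar₁ d √(d * p) = -(√(d * p) * (sphChar d √(d * p) + sphChar₂ d √(d * p))) / (d - 1) := by
    rw [eq_div_iff hd1]; linarith
  simp only [id, mul_one]
  rw [h3, scaledChar, scaledRem]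
  field_simp
  ring

theorem hasDerivAt_exp_neg_half (x : ℝ) :
    HasDerivAt (fun x => Real.exp (-x / 2)) (-(Real.exp (-x / 2)) / 2) x := by
  convert! ((hasDerivAt_neg x).div_const 2).exp using 1
  ring

/-- `exp(-p / 2)` solves the same equation without the remainder term, which is at most `1 / (d -
1)`; Grönwall doubles it. The bound is uniform in `p`. -/
theorem abs_scaledChar_sub_exp_le (hd : 2 ≤ d) {p : ℝ} (hp : 0 ≤ p) :
    |scaledChar d p - Real.exp (-p / 2)| ≤ 2 / (d - 1) := by
  have hd' : (2 : ℝ) ≤ d := by exact_mod_cast hd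
  have hd1 : (0 : ℝ) < d - 1 := by linarith
  have := abs_le_of_abs_deriv_add_half_le (ε := 1 / (d - 1)) (by positivity)
    ((continuous_scaledChar d).sub (by fun_prop : Continuous fun x : ℝ => Real.exp (-x / 2)))
    (by simp [scaledChar_zero]) hp
    (fun x hx _ => (hasDerivAt_scaledChar hd hx).sub (hasDerivAt_exp_neg_half x))
    (fun x hx _ => ?_)
  · rwa [← mul_div_assoc, mul_one] at this
  · have h1 : -(scaledChar d x) / 2 - scaledRem d x / (2 * (d - 1)) - -(Real.exp (-x / 2)) / 2 +
      (scaledChar d x - Real.exp (-x / 2)) / 2 = -(scaledRem d x / (2 * (d - 1))) := by ring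
    have h2 : |2 * ((d : ℝ) - 1)| = 2 * (d - 1) := abs_of_pos (by positivity)
    rw [Pi.sub_apply, h1, abs_neg, abs_div, h2, div_le_div_iff₀ (by positivity) hd1]
    nlinarith [abs_scaledRem_le d x]

/-- With `t² = d p`, both forms of Bessel's equation give the remainder as `(d p / (d - 1)) (f +
f'') - t f'''`. Here `f` is near `exp(-p / 2)`, while `f''` and `f'''` are at most `1 / d`; the term
`t f'''` determines the rate `1 / √d`. -/
theorem abs_scaledRem_sub_le (hd : 2 ≤ d) {M p : ℝ} (hM : 1 ≤ M) (hp : 0 < p) (hpM : p ≤ M) :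
    |scaledRem d p - p * Real.exp (-p / 2)| ≤ 5 * M / √(d - 1) := by
  have hd' : (2 : ℝ) ≤ d := by exact_mod_cast hd
  have hd1 : (0 : ℝ) < d - 1 := by linarith
  have hdp : 0 < d * p := by positivity
  have ht : 0 < √(d * p) := Real.sqrt_pos.2 hdp
  have hE := abs_scaledChar_sub_exp_le hd hp.le
  have h1 := mul_sphChar_add_sphChar₂ (d := d) ht
  have h2 := deriv_mul_sphChar_add_sphChar₂ (d := d) ht
  have hb := abs_scaledChar_le d p
  have hb2 := abs_sphChar₂_le (d := d) √(d * p)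
  have hb3 := abs_sphChar₃_le (d := d) √(d * p)
  have hsq := Real.mul_self_sqrt hdp.le
  set t := √(d * p) with htdef
  have hchar : scaledChar d p = sphChar d t := rfl
  have hrem : scaledRem d p = sphChar d t + d * sphChar₂ d t := rfl
  have e1 : sphChar₁ d t = -(t * (sphChar d t + sphChar₂ d t)) / (d - 1) := by
    rw [eq_div_iff hd1.ne']; linarith
  have e2 : scaledRem d p = d * p / (d - 1) * (sphChar d t + sphChar₂ d t) - t * sphChar₃ d t := by
    have : scaledRem d p = -t * sphChar₁ d t - t * sphChar₃ d t := by rw [hrem]; linarith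
    rw [this, e1, ← hsq]; ring
  have e3 : scaledRem d p - p * Real.exp (-p / 2) = p / (d - 1) * scaledChar d p +
      p * (scaledChar d p - Real.exp (-p / 2)) + p / (d - 1) * (d * sphChar₂ d t)
      - t * sphChar₃ d t := by
    rw [e2, hchar]; field_simp; ring
  have hdpos : (0 : ℝ) < d := by linarith
  have b1 : |p / (d - 1) * scaledChar d p| ≤ p / (d - 1) := by
    rw [abs_mul, abs_of_pos (div_pos hp hd1)]
    exact mul_le_of_le_one_right (by positivity) hb
  have b2 : |p * (scaledChar d p - Real.exp (-p / 2))| ≤ p * (2 / (d - 1)) := by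
    rw [abs_mul, abs_of_pos hp]
    exact mul_le_mul_of_nonneg_left hE hp.le
  have b3 : |p / (d - 1) * (d * sphChar₂ d t)| ≤ p / (d - 1) := by
    rw [abs_mul, abs_of_pos (div_pos hp hd1), abs_mul, abs_of_pos hdpos]
    rw [le_div_iff₀ hdpos] at hb2
    exact mul_le_of_le_one_right (by positivity) (by linarith)
  have hs1 : 0 < √((d : ℝ) - 1) := Real.sqrt_pos.2 hd1
  have hs2 : √((d : ℝ) - 1) * √((d : ℝ) - 1) = d - 1 := Real.mul_self_sqrt hd1.le
  have b4 : |t * sphChar₃ d t| ≤ M / √(d - 1) := by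
    rw [abs_mul, abs_of_pos ht]
    have htM : t ≤ M * d / √(d - 1) := by
      rw [le_div_iff₀ hs1, htdef, ← Real.sqrt_mul hdp.le]
      refine Real.sqrt_le_iff.2 ⟨by positivity, ?_⟩
      have : p * (d - 1) * d ≤ M * d * d := by
        refine mul_le_mul_of_nonneg_right ?_ hdpos.le
        exact mul_le_mul hpM (by linarith) hd1.le (by linarith)
      nlinarith [mul_nonneg (sub_nonneg.2 hM) (by positivity : 0 ≤ M * d * d)]
    calc t * |sphChar₃ d t| ≤ M * d / √(d - 1) * (1 / d) :=
          mul_le_mul htM hb3 (abs_nonneg _) (by positivity)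
      _ = M / √(d - 1) := by field_simp
  have b5 : 4 * (p / (d - 1)) ≤ 4 * (M / √(d - 1)) := by
    refine mul_le_mul_of_nonneg_left ?_ (by norm_num)
    refine div_le_div₀ (by linarith) hpM hs1 ?_
    rw [Real.sqrt_le_iff]
    constructor <;> nlinarith
  rw [e3]
  have := abs_sub (p / (d - 1) * scaledChar d p +
      p * (scaledChar d p - Real.exp (-p / 2)) + p / (d - 1) * (d * sphChar₂ d t)) (t * sphChar₃ d t)
  have := abs_add_three (p / (d - 1) * scaledChar d p)
    (p * (scaledChar d p - Real.exp (-p / 2))) (p / (d - 1) * (d * sphChar₂ d t))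
  calc _ ≤ p / (d - 1) + p * (2 / (d - 1)) + p / (d - 1) + M / √(d - 1) := by linarith
    _ = 4 * (p / (d - 1)) + M / √(d - 1) := by ring
    _ ≤ 4 * (M / √(d - 1)) + M / √(d - 1) := by linarith
    _ = 5 * M / √(d - 1) := by ring

/-- Pairs of orthogonal directions are negatively correlated, to first order in `1 / d`. -/
theorem scaledChar_add_sub_mul_le (hd : 2 ≤ d) {K p q : ℝ} (hK : 1 ≤ K) (hp : 0 ≤ p) (hpK : p ≤ K)
    (hq : 0 ≤ q) (hqK : q ≤ K) :
    2 * (d - 1) * (scaledChar d (p + q) - scaledChar d p * scaledChar d q) ≤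
      -(p * Real.exp (-p / 2) * (q * Real.exp (-q / 2))) + 44 * K / √(d - 1) := by
  have hd' : (2 : ℝ) ≤ d := by exact_mod_cast hd
  have hd1 : (0 : ℝ) < d - 1 := by linarith
  have hs1 : 0 < √((d : ℝ) - 1) := Real.sqrt_pos.2 hd1
  have hs2 : √((d : ℝ) - 1) ≤ d - 1 := by
    rw [Real.sqrt_le_iff]
    constructor <;> nlinarith
  set c : ℝ := 1 / (2 * (d - 1)) with hc
  have hcpos : 0 < c := by positivity
  -- The last term is the conjectured leading part. Applying `y' + y / 2`, it contributes `c q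
  -- exp(-(x + q) / 2)`, which cancels the limit of `-c (scaledRem (x + q) - scaledRem x *
  -- scaledChar q)`. The rest is bounded by `10K + 10K + 2K = 22K` times `c / √(d - 1)`.
  let y : ℝ → ℝ := fun x => scaledChar d (x + q) - scaledChar d x * scaledChar d q +
    c * (x * (q * Real.exp (-(x + q) / 2)))
  have hΨ := continuous_scaledChar d
  have key := abs_le_of_abs_deriv_add_half_le (y := y) (ε := c * (22 * K / √(d - 1)))
    (y' := fun x => -(scaledChar d (x + q)) / 2 - scaledRem d (x + q) / (2 * (d - 1)) -
      (-(scaledChar d x) / 2 - scaledRem d x / (2 * (d - 1))) * scaledChar d q +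
      c * (q * Real.exp (-(x + q) / 2) + x * (q * (-(Real.exp (-(x + q) / 2)) / 2))))
    (by positivity) (by fun_prop) (by simp [y, scaledChar_zero]) hp ?_ ?_
  · have h1 := (abs_le.1 key).2
    have hexp : Real.exp (-(p + q) / 2) = Real.exp (-p / 2) * Real.exp (-q / 2) := by
      rw [← Real.exp_add]; ring_nf
    have h2 : 2 * (d - 1) * y p ≤ 2 * (d - 1) * (2 * (c * (22 * K / √(d - 1)))) :=
      mul_le_mul_of_nonneg_left h1 (by positivity)
    have h3 : 2 * ((d : ℝ) - 1) * c = 1 := by rw [hc]; field_simp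
    have h4 : 2 * ((d : ℝ) - 1) * y p = 2 * (d - 1) *
        (scaledChar d (p + q) - scaledChar d p * scaledChar d q) +
        (2 * (d - 1) * c) * (p * (q * Real.exp (-(p + q) / 2))) := by simp only [y]; ring
    have h5 : 2 * ((d : ℝ) - 1) * (2 * (c * (22 * K / √(d - 1)))) =
        (2 * (d - 1) * c) * (44 * K / √(d - 1)) := by ring
    rw [h4, h5, h3, hexp] at h2
    linarith
  · intro x hx _
    have h1 := (hasDerivAt_scaledChar (d := d) hd (add_pos_of_pos_of_nonneg hx hq)).comp_add_const x q
    have h2 := (hasDerivAt_scaledChar hd hx).mul_const (scaledChar d q)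
    have h3 := ((hasDerivAt_id x).mul
      (((hasDerivAt_exp_neg_half (x + q)).comp_add_const x q).const_mul q)).const_mul c
    convert! (h1.sub h2).add h3 using 1
    simp
  · intro x hx hxp
    have hr1 := abs_scaledRem_sub_le hd (M := 2 * K) (by linarith)
      (add_pos_of_pos_of_nonneg hx hq) (by linarith)
    have hr2 := abs_scaledRem_sub_le hd (M := 2 * K) (by linarith) hx (by linarith)
    have hb := abs_scaledChar_le d q
    have hE := abs_scaledChar_sub_exp_le hd hq
    have hexp : Real.exp (-(x + q) / 2) = Real.exp (-x / 2) * Real.exp (-q / 2) := by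
      rw [← Real.exp_add]; ring_nf
    have e : -(scaledChar d (x + q)) / 2 - scaledRem d (x + q) / (2 * (d - 1)) -
        (-(scaledChar d x) / 2 - scaledRem d x / (2 * (d - 1))) * scaledChar d q +
        c * (q * Real.exp (-(x + q) / 2) + x * (q * (-(Real.exp (-(x + q) / 2)) / 2))) + y x / 2
        = -c * ((scaledRem d (x + q) - (x + q) * Real.exp (-(x + q) / 2)) -
          (scaledRem d x - x * Real.exp (-x / 2)) * scaledChar d q -
          x * Real.exp (-x / 2) * (scaledChar d q - Real.exp (-q / 2))) := by
      simp only [y, hexp, hc]; ring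
    rw [e, abs_mul, abs_neg, abs_of_pos hcpos]
    refine mul_le_mul_of_nonneg_left ?_ hcpos.le
    have b2 : |(scaledRem d x - x * Real.exp (-x / 2)) * scaledChar d q| ≤
        5 * (2 * K) / √(d - 1) := by
      rw [abs_mul]
      exact (mul_le_of_le_one_right (abs_nonneg _) hb).trans hr2
    have b3 : |x * Real.exp (-x / 2) * (scaledChar d q - Real.exp (-q / 2))| ≤
        K * (2 / √(d - 1)) := by
      rw [abs_mul, abs_of_pos (mul_pos hx (Real.exp_pos _))]
      refine mul_le_mul ?_ (hE.trans (div_le_div_of_nonneg_left (by norm_num) hs1 hs2))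
        (abs_nonneg _) (by linarith)
      refine (mul_le_of_le_one_right hx.le ?_).trans (hxp.le.trans hpK)
      exact Real.exp_le_one_iff.2 (by linarith)
    refine (abs_sub _ _).trans ((add_le_add ((abs_sub _ _).trans (add_le_add hr1 b2)) b3).trans ?_)
    exact le_of_eq (by ring)

/-- A crude bound without restriction on `p`, `q`, for the rare large frequencies: three
replacements of `Ψ` by the multiplicative `exp(-p / 2)`, each costing `2 / (d - 1)`. -/
theorem scaledChar_add_sub_mul_le_of_nonneg (hd : 2 ≤ d) {p q : ℝ} (hp : 0 ≤ p) (hq : 0 ≤ q) :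
    2 * (d - 1) * (scaledChar d (p + q) - scaledChar d p * scaledChar d q) ≤ 12 := by
  have hd' : (2 : ℝ) ≤ d := by exact_mod_cast hd
  have hd1 : (0 : ℝ) < d - 1 := by linarith
  have h1 := abs_scaledChar_sub_exp_le hd hp
  have h2 := abs_scaledChar_sub_exp_le hd hq
  have h3 := abs_scaledChar_sub_exp_le hd (add_nonneg hp hq)
  have hexp : Real.exp (-(p + q) / 2) = Real.exp (-p / 2) * Real.exp (-q / 2) := by
    rw [← Real.exp_add]; ring_nf
  have h4 : |Real.exp (-p / 2) * (scaledChar d q - Real.exp (-q / 2))| ≤ 2 / (d - 1) := by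
    rw [abs_mul, Real.abs_exp]
    refine (mul_le_of_le_one_left (abs_nonneg _) ?_).trans h2
    exact Real.exp_le_one_iff.2 (by linarith)
  have h5 : |(scaledChar d p - Real.exp (-p / 2)) * scaledChar d q| ≤ 2 / (d - 1) := by
    rw [abs_mul]
    exact (mul_le_of_le_one_right (abs_nonneg _) (abs_scaledChar_le d q)).trans h1
  have h6 : scaledChar d (p + q) - scaledChar d p * scaledChar d q ≤ 3 * (2 / (d - 1)) := by
    rw [hexp] at h3
    linarith [(abs_le.1 h3).2, (abs_le.1 h4).1, (abs_le.1 h5).1]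
  calc _ ≤ 2 * ((d : ℝ) - 1) * (3 * (2 / (d - 1))) := mul_le_mul_of_nonneg_left h6 (by positivity)
    _ = 12 := by field_simp; norm_num

end

/-! ### Negative correlation for radial profiles living in all dimensions -/

section


section Radial

variable {d : ℕ} [NeZero d] {ρ : Measure (E d)} [IsProbabilityMeasure ρ] {θ : ℝ → ℝ}

/-- Average the hypothesis over all rotations of `z` and exchange the integrals. -/
theorem integral_sphChar_norm (hθ : ∀ z : E d, ∫ ω, Real.cos (inner ℝ ω z) ∂ρ = θ ‖z‖)
    {r : ℝ} (hr : 0 ≤ r) : ∫ ω, sphChar d (‖ω‖ * r) ∂ρ = θ r := by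
  set z : E d := EuclideanSpace.single 0 r with hz
  have hzn : ‖z‖ = r := by simp [hz, abs_of_nonneg hr]
  have hm : Measurable fun x : E d × O d => Real.cos (inner ℝ x.1 (rotate x.2 z)) := by
    have h1 : Measurable fun x : E d × O d => rotate x.2 z :=
      (continuous_rotate z).measurable.comp measurable_snd
    exact Real.measurable_cos.comp (measurable_fst.inner h1)
  have hi : Integrable (Function.uncurry fun (ω : E d) (Q : O d) =>
      Real.cos (inner ℝ ω (rotate Q z))) (ρ.prod (haarO d)) :=
    integrable_of_abs_le (C := 1) hm fun x => Real.abs_cos_le_one _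
  have h1 : ∀ ω : E d, sphChar d (‖ω‖ * r) =
      ∫ Q, Real.cos (inner ℝ ω (rotate Q z)) ∂(haarO d) := by
    intro ω
    simp only [real_inner_comm _ ω]
    simp only [integral_cos_inner_rotate, hzn, mul_comm]
  simp only [h1]
  rw [integral_integral_swap hi]
  simp only [hθ, norm_rotate, hzn]
  simp

theorem scaledChar_norm_sq {r : ℝ} (hr : 0 ≤ r) (ω : E d) :
    scaledChar d (r ^ 2 * (‖ω‖ ^ 2 / d)) = sphChar d (‖ω‖ * r) := by
  have hd : (d : ℝ) ≠ 0 := Nat.cast_ne_zero.2 (NeZero.ne d)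
  have : (d : ℝ) * (r ^ 2 * (‖ω‖ ^ 2 / d)) = (‖ω‖ * r) ^ 2 := by field_simp
  rw [scaledChar, this, Real.sqrt_sq (by positivity)]

/-- A quantitative form of Schoenberg's theorem: the profile is nearly a Gaussian mixture, mixed
over `‖ω‖² / d`. -/
theorem abs_integral_exp_sub_le (hd : 2 ≤ d)
    (hθ : ∀ z : E d, ∫ ω, Real.cos (inner ℝ ω z) ∂ρ = θ ‖z‖) {r : ℝ} (hr : 0 ≤ r) :
    |θ r - ∫ ω, Real.exp (-(r ^ 2 * (‖ω‖ ^ 2 / d)) / 2) ∂ρ| ≤ 2 / (d - 1) := by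
  have hs := continuous_scaledChar d
  have h1 : Integrable (fun ω : E d => scaledChar d (r ^ 2 * (‖ω‖ ^ 2 / d))) ρ :=
    integrable_of_abs_le (by fun_prop) fun _ => abs_scaledChar_le d _
  have h2 : Integrable (fun ω : E d => Real.exp (-(r ^ 2 * (‖ω‖ ^ 2 / d)) / 2)) ρ :=
    integrable_of_abs_le (C := 1) (by fun_prop) fun ω => by
      rw [Real.abs_exp, Real.exp_le_one_iff]
      have : 0 ≤ r ^ 2 * (‖ω‖ ^ 2 / d) := by positivity
      linarith
  rw [← integral_sphChar_norm hθ hr]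
  simp only [← scaledChar_norm_sq hr]
  rw [← integral_sub h1 h2]
  have := norm_integral_le_of_norm_le_const (μ := ρ)
    (f := fun ω : E d => scaledChar d (r ^ 2 * (‖ω‖ ^ 2 / d)) -
      Real.exp (-(r ^ 2 * (‖ω‖ ^ 2 / d)) / 2)) (C := 2 / (d - 1))
    (Filter.Eventually.of_forall fun ω => abs_scaledChar_sub_exp_le hd (by positivity))
  simpa using this

/-- A smooth majorant for the indicator of large `n`. Its mean is about `2 (1 - θ(r'))`, hence small
for suitable `r'`, which replaces a moment assumption. -/
theorem le_or_one_le_tail {r r' n K : ℝ} (hr' : 0 < r') (hK : 2 * r ^ 2 / r' ^ 2 ≤ K) :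
    r ^ 2 * n ≤ K ∨ 1 ≤ 2 * (1 - Real.exp (-(r' ^ 2 * n) / 2)) := by
  by_cases h : r' ^ 2 * n ≤ 2
  · left
    refine le_trans ?_ hK
    rw [le_div_iff₀ (by positivity)]
    nlinarith [mul_le_mul_of_nonneg_left h (sq_nonneg r)]
  · right
    push Not at h
    have h1 : Real.exp (-(r' ^ 2 * n) / 2) ≤ Real.exp (-1) := Real.exp_le_exp.2 (by linarith)
    have h2 := Real.exp_neg_one_lt_d9
    linarith

theorem exists_forall_one_div_sqrt_le {ε : ℝ} (hε : 0 < ε) :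
    ∃ d₀ : ℕ, ∀ d : ℕ, d₀ ≤ d → 2 ≤ d ∧ 1 / √((d : ℝ) - 1) ≤ ε ∧ 1 / ((d : ℝ) - 1) ≤ ε := by
  obtain ⟨N, hN⟩ := exists_nat_ge ((1 / ε) ^ 2 + 1 / ε)
  refine ⟨N + 2, fun d hd => ?_⟩
  have h1 : (N : ℝ) + 2 ≤ d := by exact_mod_cast hd
  have h2 : 0 < 1 / ε := by positivity
  have h3 : 0 ≤ (1 / ε) ^ 2 := sq_nonneg _
  refine ⟨by omega, ?_, ?_⟩
  · rw [one_div_le (Real.sqrt_pos.2 (by linarith)) hε]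
    exact Real.le_sqrt_of_sq_le (by linarith)
  · rw [one_div_le (by linarith) hε]
    linarith

theorem mul_exp_neg_half_le_one (p : ℝ) : p * Real.exp (-p / 2) ≤ 1 := by
  have h1 := Real.add_one_le_exp (p / 2)
  have h2 := Real.add_one_le_exp (p / 2 - 1)
  have h4 : Real.exp (p / 2 - 1) ≤ Real.exp (p / 2) / 2 := by
    rw [Real.exp_sub]
    exact div_le_div_of_nonneg_left (Real.exp_pos _).le (by norm_num)
      (by linarith [Real.exp_one_gt_d9])
  rw [neg_div, Real.exp_neg, ← div_eq_mul_inv, div_le_one (Real.exp_pos _)]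
  linarith

end Radial

/-- For a radial characteristic function that exists in all dimensions, the feature values at
orthogonal directions are negatively correlated in high dimension. -/
theorem exists_forall_integral_sphChar_le (ρ : (d : ℕ) → Measure (E d))
    [∀ d, IsProbabilityMeasure (ρ d)] {θ : ℝ → ℝ}
    (hθ : ∀ (d : ℕ) (z : E d), ∫ ω, Real.cos (inner ℝ ω z) ∂(ρ d) = θ ‖z‖)
    (hc : ∀ η > 0, ∃ r' > 0, 1 - η ≤ θ r') {r : ℝ} (hr : 0 ≤ r) :
    ∃ d₀ : ℕ, ∀ (d : ℕ) [NeZero d], d₀ ≤ d →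
      ∫ w : E d × E d, sphChar d (r * √(‖w.1‖ ^ 2 + ‖w.2‖ ^ 2)) ∂((ρ d).prod (ρ d)) ≤ θ r ^ 2 := by
  by_cases hθr : 1 ≤ θ r
  · refine ⟨0, fun d _ _ => ?_⟩
    have := norm_integral_le_of_norm_le_const (μ := (ρ d).prod (ρ d)) (C := 1)
      (f := fun w : E d × E d => sphChar d (r * √(‖w.1‖ ^ 2 + ‖w.2‖ ^ 2)))
      (Filter.Eventually.of_forall fun w => abs_sphChar_le _)
    simp only [probReal_univ, mul_one, Real.norm_eq_abs] at this
    nlinarith [(abs_le.1 this).2]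
  push Not at hθr
  set δ := 1 - θ r with hδ
  have hδ0 : 0 < δ := by linarith
  -- The choices `δ / 8` here and `u ≤ δ / 24` make `∫ (T r - 2 T r₀) ≥ 3δ/2 - 12u ≥ δ`, so that `c`
  -- is a lower bound for the mean of `g`, independent of `d`.
  obtain ⟨r₀, hr₀, hθ₀⟩ := hc (δ / 8) (by positivity)
  set K₀ := 2 * r ^ 2 / r₀ ^ 2 with hK₀
  set c := δ * Real.exp (-K₀ / 2) with hcdef
  have hcpos : 0 < c := by positivity
  -- The tail term below has integral at most `13 * 4 * (1 - θ r₁ + 2u)`. This costs `52 c² / 208 =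
  -- c² / 4` plus `104 u`; the second entry of `u` keeps `(44 K₁ + 104) u` below another `c² / 4`.
  obtain ⟨r₁, hr₁, hθ₁⟩ := hc (c ^ 2 / 208) (by positivity)
  set K₁ := max 1 (2 * r ^ 2 / r₁ ^ 2) with hK₁
  have hK₁1 : 1 ≤ K₁ := le_max_left _ _
  set u := min (δ / 24) (c ^ 2 / (4 * (44 * K₁ + 104))) with hu
  obtain ⟨d₀, hd₀⟩ := exists_forall_one_div_sqrt_le (ε := u) (by positivity)
  refine ⟨d₀, fun d _ hd => ?_⟩
  obtain ⟨hd2, hu1, hu2⟩ := hd₀ d hd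
  have hd' : (2 : ℝ) ≤ d := by exact_mod_cast hd2
  have hd1 : (0 : ℝ) < d - 1 := by linarith
  have huδ : u ≤ δ / 24 := min_le_left _ _
  have huc : (44 * K₁ + 104) * u ≤ c ^ 2 / 4 := by
    have : u ≤ c ^ 2 / (4 * (44 * K₁ + 104)) := min_le_right _ _
    rw [le_div_iff₀ (by positivity)] at this
    linarith
  have hu3 : 2 / ((d : ℝ) - 1) ≤ 2 * u := by
    calc 2 / ((d : ℝ) - 1) = 2 * (1 / (d - 1)) := by ring
      _ ≤ 2 * u := by linarith
  let P : E d → ℝ := fun ω => r ^ 2 * (‖ω‖ ^ 2 / d)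
  obtain ⟨T, hT⟩ : ∃ T : ℝ → E d → ℝ,
      T = fun s ω => 2 * (1 - Real.exp (-(s ^ 2 * (‖ω‖ ^ 2 / d)) / 2)) := ⟨_, rfl⟩
  have hPm : Measurable P := by fun_prop
  have hP0 : ∀ ω, 0 ≤ P ω := fun ω => by positivity
  have hexpi : ∀ s : ℝ, Integrable (fun ω => Real.exp (-(s ^ 2 * (‖ω‖ ^ 2 / d)) / 2)) (ρ d) :=
    fun s => integrable_of_abs_le (C := 1) (by fun_prop) fun ω => by
      rw [Real.abs_exp, Real.exp_le_one_iff]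
      have : 0 ≤ s ^ 2 * (‖ω‖ ^ 2 / d) := by positivity
      linarith
  have hT0 : ∀ s ω, 0 ≤ T s ω := fun s ω => by
    have h1 : 0 ≤ s ^ 2 * (‖ω‖ ^ 2 / d) := by positivity
    have h2 : Real.exp (-(s ^ 2 * (‖ω‖ ^ 2 / d)) / 2) ≤ 1 := Real.exp_le_one_iff.2 (by linarith)
    simp only [hT]
    linarith
  have hTi : ∀ s, Integrable (T s) (ρ d) := fun s => by
    rw [hT]
    exact ((integrable_const 1).sub (hexpi s)).const_mul 2
  have hTint : ∀ s, ∫ ω, T s ω ∂(ρ d) =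
      2 * (1 - ∫ ω, Real.exp (-(s ^ 2 * (‖ω‖ ^ 2 / d)) / 2) ∂(ρ d)) := fun s => by
    simp only [hT]
    rw [integral_const_mul, integral_sub (integrable_const 1) (hexpi s)]
    simp
  have hTle : ∀ s, 0 ≤ s → ∫ ω, T s ω ∂(ρ d) ≤ 2 * (1 - θ s + 2 * u) := fun s hs => by
    rw [hTint]
    linarith [(abs_le.1 (abs_integral_exp_sub_le hd2 (hθ d) hs)).2]
  let g : E d → ℝ := fun ω => P ω * Real.exp (-P ω / 2)
  have hg0 : ∀ ω, 0 ≤ g ω := fun ω => mul_nonneg (hP0 ω) (Real.exp_pos _).le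
  have hg1 : ∀ ω, g ω ≤ 1 := fun ω => mul_exp_neg_half_le_one _
  have hgi : Integrable g (ρ d) := integrable_of_abs_le (C := 1) (by fun_prop) fun ω => by
    rw [abs_of_nonneg (hg0 ω)]; exact hg1 ω
  have hm : c ≤ ∫ ω, g ω ∂(ρ d) := by
    -- For `P ω ≤ K₀` use `1 - exp(-x) ≤ x`; otherwise `T r₀ ω ≥ 1` and `T r ω ≤ 2` make the left
    -- side nonpositive.
    have hle : ∀ ω, Real.exp (-K₀ / 2) * (T r ω - 2 * T r₀ ω) ≤ g ω := by
      intro ω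
      have hTr : T r ω = 2 * (1 - Real.exp (-P ω / 2)) := by rw [hT]
      rcases le_or_one_le_tail (n := ‖ω‖ ^ 2 / d) hr₀ hK₀.ge with h | h
      · have h1 := Real.add_one_le_exp (-P ω / 2)
        have h2 : Real.exp (-K₀ / 2) ≤ Real.exp (-P ω / 2) :=
          Real.exp_le_exp.2 (by simp only [P]; linarith)
        calc _ ≤ Real.exp (-K₀ / 2) * P ω := by
              refine mul_le_mul_of_nonneg_left ?_ (Real.exp_pos _).le
              linarith [hT0 r₀ ω]
          _ ≤ Real.exp (-P ω / 2) * P ω := mul_le_mul_of_nonneg_right h2 (hP0 ω)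
          _ = g ω := mul_comm _ _
      · refine le_trans (mul_nonpos_of_nonneg_of_nonpos (Real.exp_pos _).le ?_) (hg0 ω)
        have h1 : 1 ≤ T r₀ ω := by rwa [hT]
        linarith [Real.exp_pos (-P ω / 2)]
    have h1 : ∫ ω, Real.exp (-K₀ / 2) * (T r ω - 2 * T r₀ ω) ∂(ρ d) ≤ ∫ ω, g ω ∂(ρ d) :=
      integral_mono (((hTi r).sub ((hTi r₀).const_mul 2)).const_mul
        (Real.exp (-K₀ / 2))) hgi hle
    rw [integral_const_mul, integral_sub (hTi r) ((hTi r₀).const_mul 2), integral_const_mul] at h1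
    refine le_trans ?_ h1
    rw [hcdef, mul_comm]
    refine mul_le_mul_of_nonneg_left ?_ (Real.exp_pos _).le
    have h2 := hTle r₀ hr₀.le
    have h3 := (abs_le.1 (abs_integral_exp_sub_le hd2 (hθ d) hr)).1
    rw [hTint r]
    linarith
  have hs := continuous_scaledChar d
  have hD : ∀ w : E d × E d, 2 * (d - 1) * (scaledChar d (P w.1 + P w.2) -
      scaledChar d (P w.1) * scaledChar d (P w.2)) ≤
      -(g w.1 * g w.2) + (44 * K₁ * u + 13 * (T r₁ w.1 + T r₁ w.2)) := by
    intro w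
    have hu0 : 0 ≤ 44 * K₁ * u := by positivity
    have hKr : 2 * r ^ 2 / r₁ ^ 2 ≤ K₁ := le_max_right _ _
    -- The weight `13` covers the crude bound `12` and the term `g w.1 * g w.2 ≤ 1`.
    have hlarge : 1 ≤ T r₁ w.1 + T r₁ w.2 → 2 * (d - 1) * (scaledChar d (P w.1 + P w.2) -
      scaledChar d (P w.1) * scaledChar d (P w.2)) ≤
      -(g w.1 * g w.2) + (44 * K₁ * u + 13 * (T r₁ w.1 + T r₁ w.2)) := by
      intro h
      have h1 := scaledChar_add_sub_mul_le_of_nonneg hd2 (hP0 w.1) (hP0 w.2)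
      have h2 := mul_le_one₀ (hg1 w.1) (hg0 w.2) (hg1 w.2)
      linarith
    rcases le_or_one_le_tail (n := ‖w.1‖ ^ 2 / d) hr₁ hKr with h1 | h1
    · rcases le_or_one_le_tail (n := ‖w.2‖ ^ 2 / d) hr₁ hKr with h2 | h2
      · have h3 := scaledChar_add_sub_mul_le hd2 hK₁1 (hP0 w.1) h1 (hP0 w.2) h2
        have h4 : 44 * K₁ / √((d : ℝ) - 1) ≤ 44 * K₁ * u := by
          rw [div_eq_mul_one_div]
          exact mul_le_mul_of_nonneg_left hu1 (by positivity)
        refine h3.trans ?_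
        have := hT0 r₁ w.1
        have := hT0 r₁ w.2
        simp only [g]
        linarith
      · exact hlarge (by linarith [hT0 r₁ w.1, show 1 ≤ T r₁ w.2 by rwa [hT]])
    · exact hlarge (by linarith [hT0 r₁ w.2, show 1 ≤ T r₁ w.1 by rwa [hT]])
  have hi1 : Integrable (fun w : E d × E d => scaledChar d (P w.1 + P w.2))
      ((ρ d).prod (ρ d)) := integrable_of_abs_le (by fun_prop) fun _ => abs_scaledChar_le d _
  have hi0 : Integrable (fun ω => scaledChar d (P ω)) (ρ d) :=
    integrable_of_abs_le (by fun_prop) fun _ => abs_scaledChar_le d _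
  have hi2 := hi0.mul_prod hi0
  have hi3 := hgi.mul_prod hgi
  have hi4 : Integrable (fun w : E d × E d => T r₁ w.1 + T r₁ w.2) ((ρ d).prod (ρ d)) :=
    ((hTi r₁).comp_fst (ρ d)).add ((hTi r₁).comp_snd (ρ d))
  have hi3' : Integrable (fun w : E d × E d => -(g w.1 * g w.2)) ((ρ d).prod (ρ d)) := hi3.neg
  have hi5 : Integrable (fun w : E d × E d => 44 * K₁ * u + 13 * (T r₁ w.1 + T r₁ w.2))
      ((ρ d).prod (ρ d)) := (integrable_const _).add (hi4.const_mul 13)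
  have h1 : ∫ w : E d × E d, 2 * (d - 1) * (scaledChar d (P w.1 + P w.2) -
      scaledChar d (P w.1) * scaledChar d (P w.2)) ∂((ρ d).prod (ρ d)) ≤
      ∫ w : E d × E d, (-(g w.1 * g w.2) + (44 * K₁ * u + 13 * (T r₁ w.1 + T r₁ w.2)))
        ∂((ρ d).prod (ρ d)) :=
    integral_mono ((hi1.sub hi2).const_mul (2 * ((d : ℝ) - 1))) (hi3'.add hi5) hD
  have e1 : ∫ w : E d × E d, scaledChar d (P w.1) * scaledChar d (P w.2) ∂((ρ d).prod (ρ d))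
      = θ r ^ 2 := by
    rw [integral_prod_mul (fun ω => scaledChar d (P ω)) (fun ω => scaledChar d (P ω)),
      ← integral_sphChar_norm (hθ d) hr, sq]
    simp only [P, scaledChar_norm_sq hr]
  have e2 : ∀ w : E d × E d, sphChar d (r * √(‖w.1‖ ^ 2 + ‖w.2‖ ^ 2)) =
      scaledChar d (P w.1 + P w.2) := by
    intro w
    have hd0 : (d : ℝ) ≠ 0 := by linarith
    have : (d : ℝ) * (P w.1 + P w.2) = r ^ 2 * (‖w.1‖ ^ 2 + ‖w.2‖ ^ 2) := by
      simp only [P]; field_simp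
    rw [scaledChar, this, Real.sqrt_mul (sq_nonneg r), Real.sqrt_sq hr]
  simp only [e2]
  rw [integral_const_mul, integral_sub hi1 hi2, e1, integral_add hi3' hi5, integral_neg,
    integral_prod_mul g g, integral_add (integrable_const _) (hi4.const_mul 13),
    integral_const, integral_const_mul, integral_add ((hTi r₁).comp_fst (ρ d)) ((hTi r₁).comp_snd (ρ d)),
    integral_fun_fst, integral_fun_snd] at h1
  simp only [probReal_univ, one_smul] at h1
  have h2 := hTle r₁ hr₁.le
  have h3 : c ^ 2 ≤ (∫ ω, g ω ∂(ρ d)) * ∫ ω, g ω ∂(ρ d) := by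
    rw [sq]; exact mul_le_mul hm hm hcpos.le (hcpos.le.trans hm)
  -- The integrated bound is at most `-c² + c² / 4 + c² / 4 < 0`.
  by_contra hcon
  push Not at hcon
  have h4 := mul_pos (by positivity : 0 < 2 * ((d : ℝ) - 1)) (sub_pos.2 hcon)
  nlinarith

end

/-! ### Moments of the cosine features under the two sampling laws -/

section


section Pairs

variable {ι α : Type*} [Fintype ι] [MeasurableSpace α] {μ : Measure α} [IsProbabilityMeasure μ]

theorem map_eval_pair_pi {i j : ι} (hij : i ≠ j) :
    (Measure.pi fun _ : ι => μ).map (fun l => (l i, l j)) = μ.prod μ := by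
  have h : ProbabilityTheory.iIndepFun (fun (i : ι) (l : ι → α) => l i)
      (Measure.pi fun _ : ι => μ) :=
    ProbabilityTheory.iIndepFun_pi (X := fun _ => id) fun _ => aemeasurable_id
  have h1 := (ProbabilityTheory.indepFun_iff_map_prod_eq_prod_map_map
    (measurable_pi_apply i).aemeasurable (measurable_pi_apply j).aemeasurable).1 (h.indepFun hij)
  rw [h1]
  congr 1 <;> exact (measurePreserving_eval (fun _ : ι => μ) _).map_eq

theorem integral_eval_pair_pi {i j : ι} (hij : i ≠ j) {f : α × α → ℝ} (hf : Measurable f) :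
    ∫ l, f (l i, l j) ∂(Measure.pi fun _ : ι => μ) = ∫ w, f w ∂(μ.prod μ) := by
  rw [← map_eval_pair_pi (μ := μ) hij, integral_map (by fun_prop) hf.aestronglyMeasurable]

end Pairs

section OrthogonalSampling

variable {d s : ℕ} {ρ : Measure (E d)} [IsProbabilityMeasure ρ] {θ : ℝ → ℝ}

theorem integral_mcLaw_cos (i : Fin s) (z : E d) :
    ∫ ω, Real.cos (inner ℝ (ω i) z) ∂(mcLaw s ρ) = ∫ ω, Real.cos (inner ℝ ω z) ∂ρ :=
  integral_comp_eval (μ := fun _ : Fin s => ρ) (f := fun ω : E d => Real.cos (inner ℝ ω z))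
    (Measurable.aestronglyMeasurable (by fun_prop))

theorem integral_mcLaw_cos_mul_cos {i j : Fin s} (hij : i ≠ j) (z : E d) :
    ∫ ω, Real.cos (inner ℝ (ω i) z) * Real.cos (inner ℝ (ω j) z) ∂(mcLaw s ρ) =
      (∫ ω, Real.cos (inner ℝ ω z) ∂ρ) ^ 2 := by
  rw [mcLaw, integral_eval_pair_pi (μ := ρ) hij
    (f := fun w => Real.cos (inner ℝ w.1 z) * Real.cos (inner ℝ w.2 z)) (by fun_prop), sq]
  exact integral_prod_mul (fun ω : E d => Real.cos (inner ℝ ω z))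
    (fun ω : E d => Real.cos (inner ℝ ω z))

variable [NeZero d]

instance instIsProbabilityMeasureMapNorm :
    IsProbabilityMeasure (ρ.map fun w => ‖w‖) :=
  Measure.isProbabilityMeasure_map measurable_norm.aemeasurable

theorem integral_omcLaw {f : (Fin s → E d) → ℝ} (hf : Measurable f) {C : ℝ} (hC : ∀ ω, |f ω| ≤ C) :
    ∫ ω, f ω ∂(omcLaw s ρ) = ∫ l, (∫ Q, f (fun i => l i •
      column (Q ⟨(i : ℕ) / d, (Nat.div_le_self _ _).trans_lt i.isLt⟩) (Fin.ofNat d (i : ℕ)))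
        ∂(Measure.pi fun _ : Fin s => haarO d))
      ∂(Measure.pi fun _ : Fin s => ρ.map fun w => ‖w‖) := by
  rw [omcLaw, integral_map (measurable_omc s).aemeasurable hf.aestronglyMeasurable, integral_prod]
  exact integrable_of_abs_le (hf.comp (measurable_omc s)) fun _ => hC _

theorem inner_smul_column {n : ℕ} (l : ℝ) (Q : O n) (m : Fin n) (z : E n) :
    inner ℝ (l • column Q m) z = inner ℝ (rotate Q (l • EuclideanSpace.single m 1)) z := by
  rw [map_smul, rotate_single]

theorem measurable_inner_rotate {n : ℕ} (w z : E n) : Measurable fun Q : O n => inner ℝ (rotate Q w) z :=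
  (continuous_inner_rotate w z).measurable

theorem integral_omcLaw_cos (hθ : ∀ z : E d, ∫ ω, Real.cos (inner ℝ ω z) ∂ρ = θ ‖z‖) (i : Fin s)
    (z : E d) : ∫ ω, Real.cos (inner ℝ (ω i) z) ∂(omcLaw s ρ) = θ ‖z‖ := by
  have hc := continuous_sphChar (d := d)
  rw [integral_omcLaw (f := fun ω => Real.cos (inner ℝ (ω i) z)) (C := 1) (by fun_prop)
    fun _ => Real.abs_cos_le_one _]
  simp only [inner_smul_column]
  have h1 : ∀ l : Fin s → ℝ, ∫ Q : Fin s → O d, Real.cos (inner ℝ (rotate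
      (Q ⟨(i : ℕ) / d, (Nat.div_le_self _ _).trans_lt i.isLt⟩)
        (l i • EuclideanSpace.single (Fin.ofNat d (i : ℕ)) 1)) z)
        ∂(Measure.pi fun _ : Fin s => haarO d) = sphChar d (|l i| * ‖z‖) := by
    intro l
    have := measurable_inner_rotate (l i • EuclideanSpace.single (Fin.ofNat d (i : ℕ)) 1) z
    rw [integral_comp_eval (μ := fun _ : Fin s => haarO d) (f := fun Q : O d => Real.cos (inner ℝ
      (rotate Q (l i • EuclideanSpace.single (Fin.ofNat d (i : ℕ)) 1)) z))
      (Measurable.aestronglyMeasurable (by fun_prop)), integral_cos_inner_rotate]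
    simp [norm_smul]
  simp only [h1]
  rw [integral_comp_eval (μ := fun _ : Fin s => ρ.map fun w => ‖w‖)
    (f := fun x : ℝ => sphChar d (|x| * ‖z‖)) (Measurable.aestronglyMeasurable (by fun_prop)),
    integral_map (by fun_prop) (Measurable.aestronglyMeasurable (by fun_prop)),
    ← integral_sphChar_norm hθ (norm_nonneg z)]
  simp only [abs_norm]

/-- Product to sum: `x eₘ + y eₙ` and `x eₘ - y eₙ` have the same length, so both cosines have the
same average. -/
theorem integral_cos_mul_cos_rotate {m n : Fin d} (hmn : m ≠ n) (x y : ℝ) (z : E d) :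
    ∫ Q, Real.cos (inner ℝ (rotate Q (x • EuclideanSpace.single m 1)) z) *
      Real.cos (inner ℝ (rotate Q (y • EuclideanSpace.single n 1)) z) ∂(haarO d) =
      sphChar d (√(x ^ 2 + y ^ 2) * ‖z‖) := by
  have hi : ∀ w : E d, Integrable (fun Q => Real.cos (inner ℝ (rotate Q w) z)) (haarO d) := by
    intro w
    have := measurable_inner_rotate w z
    exact integrable_of_abs_le (C := 1) (by fun_prop) fun _ => Real.abs_cos_le_one _
  have h : ∀ A B : ℝ, Real.cos A * Real.cos B = (Real.cos (A + B) + Real.cos (A + -B)) / 2 := by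
    intro A B
    rw [Real.cos_add, ← sub_eq_add_neg, Real.cos_sub]; ring
  simp only [h, ← inner_neg_left, ← inner_add_left, ← map_neg, ← map_add, ← neg_smul]
  rw [integral_div, integral_add (hi _) (hi _)]
  simp only [integral_cos_inner_rotate, norm_smul_single_add hmn, neg_sq]
  ring

/-- Samples in one block use different columns of one matrix, and `hneg` applies; samples in
different blocks use independent matrices, and the average is exactly `θ ‖z‖ ^ 2`. -/
theorem integral_omcLaw_cos_mul_cos_le
    (hθ : ∀ z : E d, ∫ ω, Real.cos (inner ℝ ω z) ∂ρ = θ ‖z‖) (z : E d)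
    (hneg : ∫ w : E d × E d, sphChar d (‖z‖ * √(‖w.1‖ ^ 2 + ‖w.2‖ ^ 2)) ∂(ρ.prod ρ) ≤ θ ‖z‖ ^ 2)
    {i j : Fin s} (hij : i ≠ j) :
    ∫ ω, Real.cos (inner ℝ (ω i) z) * Real.cos (inner ℝ (ω j) z) ∂(omcLaw s ρ) ≤ θ ‖z‖ ^ 2 := by
  have hc := continuous_sphChar (d := d)
  rw [integral_omcLaw (f := fun ω => Real.cos (inner ℝ (ω i) z) * Real.cos (inner ℝ (ω j) z))
    (C := 1) (by fun_prop) fun _ => by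
      rw [abs_mul]
      exact mul_le_one₀ (Real.abs_cos_le_one _) (abs_nonneg _) (Real.abs_cos_le_one _)]
  simp only [inner_smul_column]
  have hmeas := fun (l : ℝ) (m : Fin d) => measurable_inner_rotate (l • EuclideanSpace.single m 1) z
  have hmap : (ρ.map fun w => ‖w‖).prod (ρ.map fun w => ‖w‖) =
      (ρ.prod ρ).map (Prod.map (fun w => ‖w‖) fun w => ‖w‖) :=
    Measure.map_prod_map _ _ measurable_norm measurable_norm
  by_cases hb : (i : ℕ) / d = (j : ℕ) / d
  · have hmn : Fin.ofNat d (i : ℕ) ≠ Fin.ofNat d (j : ℕ) := by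
      intro h
      have h1 : (i : ℕ) % d = (j : ℕ) % d := by simpa [Fin.ext_iff] using h
      apply hij
      rw [Fin.ext_iff, ← Nat.div_add_mod (i : ℕ) d, ← Nat.div_add_mod (j : ℕ) d, hb, h1]
    simp only [hb]
    have h1 : ∀ l : Fin s → ℝ, ∫ Q : Fin s → O d, Real.cos (inner ℝ (rotate
        (Q ⟨(j : ℕ) / d, (Nat.div_le_self _ _).trans_lt j.isLt⟩)
          (l i • EuclideanSpace.single (Fin.ofNat d (i : ℕ)) 1)) z) * Real.cos (inner ℝ (rotate
        (Q ⟨(j : ℕ) / d, (Nat.div_le_self _ _).trans_lt j.isLt⟩)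
          (l j • EuclideanSpace.single (Fin.ofNat d (j : ℕ)) 1)) z)
          ∂(Measure.pi fun _ : Fin s => haarO d) = sphChar d (√(l i ^ 2 + l j ^ 2) * ‖z‖) := by
      intro l
      rw [integral_comp_eval (μ := fun _ : Fin s => haarO d) (f := fun Q : O d =>
        Real.cos (inner ℝ (rotate Q (l i • EuclideanSpace.single (Fin.ofNat d (i : ℕ)) 1)) z) *
        Real.cos (inner ℝ (rotate Q (l j • EuclideanSpace.single (Fin.ofNat d (j : ℕ)) 1)) z))
        (Measurable.aestronglyMeasurable (by fun_prop)), integral_cos_mul_cos_rotate hmn]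
    simp only [h1]
    rw [integral_eval_pair_pi hij (f := fun x : ℝ × ℝ => sphChar d (√(x.1 ^ 2 + x.2 ^ 2) * ‖z‖))
      (by fun_prop), hmap, integral_map (by fun_prop)
      (Measurable.aestronglyMeasurable (by fun_prop))]
    simpa only [Prod.map_fst, Prod.map_snd, mul_comm] using hneg
  · have hne : (⟨(i : ℕ) / d, (Nat.div_le_self _ _).trans_lt i.isLt⟩ : Fin s) ≠
        ⟨(j : ℕ) / d, (Nat.div_le_self _ _).trans_lt j.isLt⟩ := by
      simpa [Fin.ext_iff] using hb
    have h1 : ∀ l : Fin s → ℝ, ∫ Q : Fin s → O d, Real.cos (inner ℝ (rotate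
        (Q ⟨(i : ℕ) / d, (Nat.div_le_self _ _).trans_lt i.isLt⟩)
          (l i • EuclideanSpace.single (Fin.ofNat d (i : ℕ)) 1)) z) * Real.cos (inner ℝ (rotate
        (Q ⟨(j : ℕ) / d, (Nat.div_le_self _ _).trans_lt j.isLt⟩)
          (l j • EuclideanSpace.single (Fin.ofNat d (j : ℕ)) 1)) z)
          ∂(Measure.pi fun _ : Fin s => haarO d) =
        sphChar d (|l i| * ‖z‖) * sphChar d (|l j| * ‖z‖) := by
      intro l
      rw [integral_eval_pair_pi hne (μ := haarO d) (f := fun Q : O d × O d =>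
        Real.cos (inner ℝ (rotate Q.1 (l i • EuclideanSpace.single (Fin.ofNat d (i : ℕ)) 1)) z) *
        Real.cos (inner ℝ (rotate Q.2 (l j • EuclideanSpace.single (Fin.ofNat d (j : ℕ)) 1)) z))
        (((Real.measurable_cos.comp (hmeas _ _)).comp measurable_fst).mul
          ((Real.measurable_cos.comp (hmeas _ _)).comp measurable_snd)),
        integral_prod_mul (fun Q : O d => Real.cos (inner ℝ (rotate Q
          (l i • EuclideanSpace.single (Fin.ofNat d (i : ℕ)) 1)) z))
        (fun Q : O d => Real.cos (inner ℝ (rotate Q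
          (l j • EuclideanSpace.single (Fin.ofNat d (j : ℕ)) 1)) z)),
        integral_cos_inner_rotate, integral_cos_inner_rotate]
      simp [norm_smul]
    simp only [h1]
    rw [integral_eval_pair_pi hij
      (f := fun x : ℝ × ℝ => sphChar d (|x.1| * ‖z‖) * sphChar d (|x.2| * ‖z‖)) (by fun_prop),
      integral_prod_mul (fun x : ℝ => sphChar d (|x| * ‖z‖)) (fun x : ℝ => sphChar d (|x| * ‖z‖)),
      integral_map (by fun_prop) (Measurable.aestronglyMeasurable (by fun_prop)), ← sq]
    simp only [abs_norm, integral_sphChar_norm hθ (norm_nonneg z), le_refl]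

end OrthogonalSampling

/-! ### Decomposition and comparison of the mean squared errors -/

section MeanSquaredError

variable {d s : ℕ}

/-- The error of the empirical characteristic function at `z`, times the number of samples. -/
def charError (C : ℝ) (z : E d) (ω : Fin s → E d) : ℝ := ∑ i, (Real.cos (inner ℝ (ω i) z) - C)

theorem measurable_charError (C : ℝ) (z : E d) :
    Measurable (charError C z : (Fin s → E d) → ℝ) := by
  unfold charError
  fun_prop

theorem abs_charError_le (C : ℝ) (z : E d) (ω : Fin s → E d) :
    |charError C z ω| ≤ s * (1 + |C|) := by
  refine (Finset.abs_sum_le_sum_abs _ _).trans ?_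
  refine (Finset.sum_le_card_nsmul _ _ (1 + |C|) fun i _ => ?_).trans_eq (by simp [mul_add])
  exact (abs_sub _ _).trans (by linarith [Real.abs_cos_le_one (inner ℝ (ω i) z)])

theorem integrable_charError (C : ℝ) (z : E d) (P : Measure (Fin s → E d)) [IsFiniteMeasure P] :
    Integrable (charError C z) P :=
  integrable_of_abs_le (measurable_charError C z) (abs_charError_le C z)

theorem integrable_charError_sq (C : ℝ) (z : E d) (P : Measure (Fin s → E d))
    [IsFiniteMeasure P] : Integrable (fun ω => charError C z ω ^ 2) P :=
  integrable_of_abs_le (C := (s * (1 + |C|)) ^ 2) ((measurable_charError C z).pow_const 2)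
    fun ω => by
      rw [abs_pow]; exact pow_le_pow_left₀ (abs_nonneg _) (abs_charError_le C z ω) 2

/-- The kernel error in terms of the errors of the two empirical characteristic functions. -/
theorem kernel_sub_approxKernel_eq (hs : 0 < s) {k a b C₁ C₂ : ℝ} (ha : 0 ≤ a) (hb : 0 ≤ b)
    (x x' : E d) (hk : k = a * C₁ - b * C₂) (ω ν : Fin s → E d) :
    (k : ℂ) - approxKernel a b ω ν x x' =
      (((b * charError C₂ (x - x') ν - a * charError C₁ (x - x') ω) / s : ℝ) : ℂ) := by
  have hs' : (s : ℝ) ≠ 0 := by positivity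
  rw [approxKernel_eq ha hb, ← Complex.ofReal_sub]
  congr 1
  simp only [charError, Finset.sum_sub_distrib, Finset.sum_const, Finset.card_univ,
    Fintype.card_fin, nsmul_eq_mul, ← Finset.mul_sum, hk]
  field_simp
  ring

/-- The cross term factors by independence of the two families and has a factor of mean zero. -/
theorem mse_eq (hs : 0 < s) (k : E d → E d → ℝ) {a b C₁ C₂ : ℝ} (ha : 0 ≤ a) (hb : 0 ≤ b)
    (x x' : E d) (hk : k x x' = a * C₁ - b * C₂) (P Q : Measure (Fin s → E d))
    [IsProbabilityMeasure P] [IsProbabilityMeasure Q]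
    (hP : ∫ ω, charError C₁ (x - x') ω ∂P = 0) :
    mse k a b P Q x x' = (a ^ 2 * ∫ ω, charError C₁ (x - x') ω ^ 2 ∂P +
      b ^ 2 * ∫ ν, charError C₂ (x - x') ν ^ 2 ∂Q) / s ^ 2 := by
  set A := fun ω : Fin s → E d => charError C₁ (x - x') ω
  set B := fun ω : Fin s → E d => charError C₂ (x - x') ω
  have h : ∀ p : (Fin s → E d) × (Fin s → E d),
      ‖(k x x' : ℂ) - approxKernel a b p.1 p.2 x x'‖ ^ 2 =
      (a ^ 2 * A p.1 ^ 2 + (b ^ 2 * B p.2 ^ 2 - 2 * a * b * (A p.1 * B p.2))) / s ^ 2 := by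
    intro p
    rw [kernel_sub_approxKernel_eq hs ha hb x x' hk, Complex.norm_real, Real.norm_eq_abs, sq_abs,
      div_pow]
    ring
  have hA := integrable_charError C₁ (x - x') P
  have hB := integrable_charError C₂ (x - x') Q
  have hA2 := ((integrable_charError_sq C₁ (x - x') P).comp_fst Q).const_mul (a ^ 2)
  have hB2 := ((integrable_charError_sq C₂ (x - x') Q).comp_snd P).const_mul (b ^ 2)
  have hAB := (hA.mul_prod hB).const_mul (2 * a * b)
  have hBAB : Integrable (fun p : (Fin s → E d) × (Fin s → E d) =>
      b ^ 2 * B p.2 ^ 2 - 2 * a * b * (A p.1 * B p.2)) (P.prod Q) := hB2.sub hAB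
  rw [mse]
  simp only [h]
  rw [integral_div, integral_add hA2 hBAB, integral_sub hB2 hAB]
  simp only [integral_const_mul]
  rw [integral_prod_mul A B, hP, zero_mul, mul_zero, sub_zero,
    integral_fun_fst (fun ω => A ω ^ 2), integral_fun_snd (fun ω => B ω ^ 2)]
  simp [A, B]

theorem integral_charError {P : Measure (Fin s → E d)} [IsProbabilityMeasure P] {C : ℝ} {z : E d}
    (h : ∀ i, ∫ ω, Real.cos (inner ℝ (ω i) z) ∂P = C) : ∫ ω, charError C z ω ∂P = 0 := by
  have hi : ∀ i, Integrable (fun ω : Fin s → E d => Real.cos (inner ℝ (ω i) z)) P := fun i =>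
    integrable_of_abs_le (C := 1) (by fun_prop) fun _ => Real.abs_cos_le_one _
  simp only [charError]
  have hi' : ∀ i, Integrable (fun ω : Fin s → E d => Real.cos (inner ℝ (ω i) z) - C) P :=
    fun i => (hi i).sub (integrable_const C)
  rw [integral_finsetSum _ fun i _ => hi' i]
  refine Finset.sum_eq_zero fun i _ => ?_
  rw [integral_sub (hi i) (integrable_const C), h]
  simp

theorem integral_charError_sq {P : Measure (Fin s → E d)} [IsProbabilityMeasure P] {C : ℝ} {z : E d}
    (h : ∀ i, ∫ ω, Real.cos (inner ℝ (ω i) z) ∂P = C) :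
    ∫ ω, charError C z ω ^ 2 ∂P = ∑ i, ∑ j,
      ((∫ ω, Real.cos (inner ℝ (ω i) z) * Real.cos (inner ℝ (ω j) z) ∂P) - C ^ 2) := by
  have hi : ∀ i, Integrable (fun ω : Fin s → E d => Real.cos (inner ℝ (ω i) z)) P := fun i =>
    integrable_of_abs_le (C := 1) (by fun_prop) fun _ => Real.abs_cos_le_one _
  have hij : ∀ i j, Integrable (fun ω : Fin s → E d =>
      Real.cos (inner ℝ (ω i) z) * Real.cos (inner ℝ (ω j) z)) P := fun i j =>
    integrable_of_abs_le (C := 1) (by fun_prop) fun _ => by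
      rw [abs_mul]
      exact mul_le_one₀ (Real.abs_cos_le_one _) (abs_nonneg _) (Real.abs_cos_le_one _)
  have hexp : ∀ (i j : Fin s) (ω : Fin s → E d), (Real.cos (inner ℝ (ω i) z) - C) *
      (Real.cos (inner ℝ (ω j) z) - C) = Real.cos (inner ℝ (ω i) z) * Real.cos (inner ℝ (ω j) z) -
      (C * Real.cos (inner ℝ (ω i) z) + C * Real.cos (inner ℝ (ω j) z) - C ^ 2) :=
    fun i j ω => by ring
  have hlin : ∀ i j, Integrable (fun ω : Fin s → E d =>
      C * Real.cos (inner ℝ (ω i) z) + C * Real.cos (inner ℝ (ω j) z)) P := fun i j =>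
    ((hi i).const_mul C).add ((hi j).const_mul C)
  have hlin' : ∀ i j, Integrable (fun ω : Fin s → E d =>
      C * Real.cos (inner ℝ (ω i) z) + C * Real.cos (inner ℝ (ω j) z) - C ^ 2) P := fun i j =>
    (hlin i j).sub (integrable_const _)
  have hsub : ∀ i j, Integrable (fun ω : Fin s → E d =>
      Real.cos (inner ℝ (ω i) z) * Real.cos (inner ℝ (ω j) z) -
      (C * Real.cos (inner ℝ (ω i) z) + C * Real.cos (inner ℝ (ω j) z) - C ^ 2)) P := fun i j =>
    (hij i j).sub (hlin' i j)
  simp only [charError, sq (∑ i, _), Finset.sum_mul_sum, hexp]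
  rw [integral_finsetSum _ fun i _ => integrable_finsetSum _ fun j _ => hsub i j]
  refine Finset.sum_congr rfl fun i _ => ?_
  rw [integral_finsetSum _ fun j _ => hsub i j]
  refine Finset.sum_congr rfl fun j _ => ?_
  rw [integral_sub (hij i j) (hlin' i j), integral_sub (hlin i j) (integrable_const _),
    integral_add ((hi i).const_mul C) ((hi j).const_mul C), integral_const_mul, integral_const_mul,
    h, h]
  simp
  ring

variable [NeZero d] {ρ : Measure (E d)} [IsProbabilityMeasure ρ] {θ : ℝ → ℝ}

/-- Compare the double sums of covariances termwise. On the diagonal `cos² A = (1 + cos 2A) / 2`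
reduces to single-sample averages at `2z`, which agree; off it the orthogonal pairs are at most the
independent ones. -/
theorem integral_charError_sq_omcLaw_le
    (hθ : ∀ z : E d, ∫ ω, Real.cos (inner ℝ ω z) ∂ρ = θ ‖z‖) (z : E d)
    (hneg : ∫ w : E d × E d, sphChar d (‖z‖ * √(‖w.1‖ ^ 2 + ‖w.2‖ ^ 2)) ∂(ρ.prod ρ) ≤ θ ‖z‖ ^ 2) :
    ∫ ω, charError (θ ‖z‖) z ω ^ 2 ∂(omcLaw s ρ) ≤ ∫ ω, charError (θ ‖z‖) z ω ^ 2 ∂(mcLaw s ρ) := by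
  have := isProbabilityMeasure_omcLaw s ρ
  have : IsProbabilityMeasure (mcLaw s ρ) := by unfold mcLaw; infer_instance
  rw [integral_charError_sq fun i => integral_omcLaw_cos hθ i z,
    integral_charError_sq fun i => (integral_mcLaw_cos i z).trans (hθ z)]
  refine Finset.sum_le_sum fun i _ => Finset.sum_le_sum fun j _ => sub_le_sub_right ?_ _
  rcases eq_or_ne i j with rfl | hij
  · have hcos : ∀ A : ℝ, Real.cos A * Real.cos A = 1 / 2 + Real.cos (2 * A) / 2 := fun A => by
      rw [← sq, Real.cos_sq]
    simp only [hcos, ← real_inner_smul_right]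
    have hi : ∀ P : Measure (Fin s → E d), IsProbabilityMeasure P → Integrable
        (fun ω : Fin s → E d => Real.cos (inner ℝ (ω i) ((2 : ℝ) • z)) / 2) P := fun P _ =>
      integrable_of_abs_le (C := 1) (by fun_prop) fun ω => by
        rw [abs_div, abs_two]; linarith [Real.abs_cos_le_one (inner ℝ (ω i) ((2 : ℝ) • z))]
    rw [integral_add (integrable_const _) (hi _ ‹_›), integral_add (integrable_const _) (hi _ ‹_›),
      integral_const, integral_const, integral_div, integral_div, integral_omcLaw_cos hθ, integral_mcLaw_cos, hθ]
    simp
  · rw [integral_mcLaw_cos_mul_cos hij, hθ]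
    exact integral_omcLaw_cos_mul_cos_le hθ z hneg hij

end MeanSquaredError

end

/-! ### Normalized measures, radial families, and variance reduction -/

section


section Normalized

variable {d : ℕ} {μ : Measure (E d)} [IsFiniteMeasure μ]

theorem isProbabilityMeasure_normalized (hμ : μ ≠ 0) : IsProbabilityMeasure (normalized μ) := by
  constructor
  rw [normalized, Measure.smul_apply, smul_eq_mul]
  exact ENNReal.inv_mul_cancel (Measure.measure_univ_ne_zero.2 hμ) (measure_ne_top μ _)

theorem real_univ_pos (hμ : μ ≠ 0) : 0 < μ.real Set.univ := by
  have : NeZero μ := ⟨hμ⟩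
  exact measureReal_univ_pos

theorem real_univ_mul_integral_normalized (hμ : μ ≠ 0) (f : E d → ℝ) :
    μ.real Set.univ * ∫ ω, f ω ∂(normalized μ) = ∫ ω, f ω ∂μ := by
  rw [normalized, integral_smul_measure, ENNReal.toReal_inv, smul_eq_mul]
  exact mul_inv_cancel_left₀ (real_univ_pos hμ).ne' _

theorem re_charFun (μ : Measure (E d)) [IsFiniteMeasure μ] (z : E d) :
    (charFun μ z).re = ∫ ω, Real.cos (inner ℝ ω z) ∂μ := by
  rw [charFun_apply]
  have hi : Integrable (fun x : E d => Complex.exp ((inner ℝ x z : ℝ) * I)) μ := by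
    refine Integrable.of_bound (C := 1) (Measurable.aestronglyMeasurable (by fun_prop))
      (Filter.Eventually.of_forall fun x => ?_)
    rw [Complex.norm_exp_ofReal_mul_I]
  have := integral_re hi
  simp only [RCLike.re_eq_complex_re, Complex.exp_ofReal_mul_I_re] at this
  exact this.symm

/-- A represented kernel in terms of the real characteristic functions of the normalized
measures. -/
theorem IsRepresentedBy.eq_sub {k : E d → E d → ℝ} {c₁ c₂ : ℝ} {μp μm : Measure (E d)}
    [IsFiniteMeasure μp] [IsFiniteMeasure μm] (h : IsRepresentedBy k c₁ c₂ μp μm)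
    (hp : μp ≠ 0) (hm : μm ≠ 0) (x x' : E d) :
    k x x' = c₁ * μp.real Set.univ * (∫ ω, Real.cos (inner ℝ ω (x - x')) ∂(normalized μp)) -
      c₂ * μm.real Set.univ * ∫ ω, Real.cos (inner ℝ ω (x - x')) ∂(normalized μm) := by
  have h1 := congrArg Complex.re (h x x')
  rw [ofReal_re, sub_re, re_ofReal_mul, re_ofReal_mul, re_charFun, re_charFun] at h1
  rw [h1, mul_assoc, mul_assoc, real_univ_mul_integral_normalized hp,
    real_univ_mul_integral_normalized hm]

end Normalized

section RadialFamily

variable {φ : ℝ → ℝ} {μ : (d : ℕ) → Measure (E d)}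

theorem real_univ_eq_of_radial (hφ : ∀ (d : ℕ) (z : E d), charFun (μ d) z = φ ‖z‖) (d : ℕ) :
    (μ d).real Set.univ = φ 0 := by
  have := congrArg Complex.re (hφ d 0)
  simpa using this

variable [∀ d, IsFiniteMeasure (μ d)]

theorem integral_cos_normalized_of_radial (hμ : ∀ d, μ d ≠ 0)
    (hφ : ∀ (d : ℕ) (z : E d), charFun (μ d) z = φ ‖z‖) (d : ℕ) (z : E d) :
    ∫ ω, Real.cos (inner ℝ ω z) ∂(normalized (μ d)) = φ ‖z‖ / φ 0 := by
  have hpos := real_univ_pos (hμ d)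
  have h := real_univ_mul_integral_normalized (hμ d) fun ω => Real.cos (inner ℝ ω z)
  rw [← re_charFun (μ d), hφ, ofReal_re, real_univ_eq_of_radial hφ] at h
  rw [real_univ_eq_of_radial hφ] at hpos
  rw [eq_div_iff hpos.ne', mul_comm, h]

/-- Continuity of the profile at `0` is read off from the characteristic function in dimension one.
-/
theorem exists_pos_one_sub_le_of_radial (hμ : ∀ d, μ d ≠ 0)
    (hφ : ∀ (d : ℕ) (z : E d), charFun (μ d) z = φ ‖z‖) {η : ℝ} (hη : 0 < η) :
    ∃ r > 0, 1 - η ≤ φ r / φ 0 := by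
  have hpos := real_univ_pos (hμ 1)
  rw [real_univ_eq_of_radial hφ] at hpos
  have hc : Continuous fun r : ℝ =>
      (charFun (μ 1) (EuclideanSpace.single (0 : Fin 1) r)).re / φ 0 := by
    have h1 : Continuous fun r : ℝ => EuclideanSpace.single (0 : Fin 1) r := by
      have : (fun r : ℝ => EuclideanSpace.single (0 : Fin 1) r) =
          fun r => r • EuclideanSpace.single (0 : Fin 1) (1 : ℝ) := by ext r i; simp
      rw [this]
      fun_prop
    exact (Complex.continuous_re.comp (continuous_charFun.comp h1)).div_const _
  have h0 := hc.tendsto 0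
  simp only [hφ, ofReal_re, PiLp.norm_single, norm_zero] at h0
  rw [div_self hpos.ne'] at h0
  have h1 := (h0.eventually (lt_mem_nhds (show 1 - η < 1 by linarith))).filter_mono
    (nhdsWithin_le_nhds (s := Set.Ioi 0))
  obtain ⟨r, hr, hr0⟩ := (h1.and self_mem_nhdsWithin).exists
  rw [Real.norm_of_nonneg (le_of_lt hr0)] at hr
  exact ⟨r, hr0, hr.le⟩

end RadialFamily

/-- Variance reduction by orthogonal sampling in high dimension. -/
theorem exists_forall_mse_omcLaw_le {φp φm : ℝ → ℝ} {c₁ c₂ : ℝ} {k : (d : ℕ) → E d → E d → ℝ}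
    {μp μm : (d : ℕ) → Measure (E d)} [∀ d, IsFiniteMeasure (μp d)] [∀ d, IsFiniteMeasure (μm d)]
    (hc₁ : 0 ≤ c₁) (hc₂ : 0 ≤ c₂) (hp : ∀ d, μp d ≠ 0) (hm : ∀ d, μm d ≠ 0)
    (hk : ∀ d, IsRepresentedBy (k d) c₁ c₂ (μp d) (μm d))
    (hφp : ∀ (d : ℕ) (z : E d), charFun (μp d) z = φp ‖z‖)
    (hφm : ∀ (d : ℕ) (z : E d), charFun (μm d) z = φm ‖z‖) (r : ℝ) :
    ∃ d₀ : ℕ, ∀ (d : ℕ) [NeZero d], d₀ ≤ d → ∀ s : ℕ, 0 < s → ∀ x x' : E d, ‖x - x'‖ = r →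
      mse (k d) (c₁ * (μp d).real Set.univ) (c₂ * (μm d).real Set.univ)
          (omcLaw s (normalized (μp d))) (omcLaw s (normalized (μm d))) x x'
        ≤ mse (k d) (c₁ * (μp d).real Set.univ) (c₂ * (μm d).real Set.univ)
          (mcLaw s (normalized (μp d))) (mcLaw s (normalized (μm d))) x x' := by
  rcases lt_or_ge r 0 with hr | hr
  · refine ⟨0, fun d _ _ s _ x x' h => ?_⟩
    linarith [norm_nonneg (x - x')]
  have ip := fun d => isProbabilityMeasure_normalized (hp d)
  have im := fun d => isProbabilityMeasure_normalized (hm d)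
  have hθp := integral_cos_normalized_of_radial hp hφp
  have hθm := integral_cos_normalized_of_radial hm hφm
  obtain ⟨d₁, h₁⟩ := exists_forall_integral_sphChar_le (fun d => normalized (μp d))
    (θ := fun r => φp r / φp 0) hθp (fun η hη => exists_pos_one_sub_le_of_radial hp hφp hη) hr
  obtain ⟨d₂, h₂⟩ := exists_forall_integral_sphChar_le (fun d => normalized (μm d))
    (θ := fun r => φm r / φm 0) hθm (fun η hη => exists_pos_one_sub_le_of_radial hm hφm hη) hr
  refine ⟨max d₁ d₂, fun d _ hd s hs x x' hx => ?_⟩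
  have hn₁ := h₁ d ((le_max_left _ _).trans hd)
  have hn₂ := h₂ d ((le_max_right _ _).trans hd)
  simp only [← hx] at hn₁ hn₂
  have ha : 0 ≤ c₁ * (μp d).real Set.univ := mul_nonneg hc₁ measureReal_nonneg
  have hb : 0 ≤ c₂ * (μm d).real Set.univ := mul_nonneg hc₂ measureReal_nonneg
  have hkeq := (hk d).eq_sub (hp d) (hm d) x x'
  rw [hθp, hθm] at hkeq
  have := isProbabilityMeasure_omcLaw s (normalized (μp d))
  have := isProbabilityMeasure_omcLaw s (normalized (μm d))
  have : IsProbabilityMeasure (mcLaw s (normalized (μp d))) := by unfold mcLaw; infer_instance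
  have : IsProbabilityMeasure (mcLaw s (normalized (μm d))) := by unfold mcLaw; infer_instance
  rw [mse_eq hs (k d) ha hb x x' hkeq _ _ (integral_charError fun i =>
      integral_omcLaw_cos (θ := fun r => φp r / φp 0) (hθp d) i (x - x')),
    mse_eq hs (k d) ha hb x x' hkeq _ _ (integral_charError fun i =>
      (integral_mcLaw_cos i (x - x')).trans (hθp d _))]
  have e₁ := integral_charError_sq_omcLaw_le (s := s) (θ := fun r => φp r / φp 0) (hθp d) (x - x') hn₁
  have e₂ := integral_charError_sq_omcLaw_le (s := s) (θ := fun r => φm r / φm 0) (hθm d) (x - x') hn₂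
  gcongr

end

/-! ### Pointwise bounds for the Monte Carlo error -/

section


instance instIsProbabilityMeasureMcLaw {d s : ℕ} (ρ : Measure (E d)) [IsProbabilityMeasure ρ] :
    IsProbabilityMeasure (mcLaw s ρ) := by unfold mcLaw; infer_instance

/-- The real part of the characteristic function. -/
def charMean {d : ℕ} (ρ : Measure (E d)) (z : E d) : ℝ := ∫ ω, Real.cos (inner ℝ ω z) ∂ρ

/-- The error of the random feature approximation of `a * charMean ρ - b * charMean ρ'`. -/
def kernelError {d s : ℕ} (a b : ℝ) (ρ ρ' : Measure (E d)) (z : E d)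
    (p : (Fin s → E d) × (Fin s → E d)) : ℝ :=
  (b * charError (charMean ρ' z) z p.2 - a * charError (charMean ρ z) z p.1) / s

section Pointwise

variable {d s : ℕ} {ρ ρ' : Measure (E d)} [IsProbabilityMeasure ρ] [IsProbabilityMeasure ρ']
  {a b : ℝ}

theorem integrable_cos_inner (z : E d) : Integrable (fun ω : E d => Real.cos (inner ℝ ω z)) ρ :=
  integrable_of_abs_le (C := 1) (by fun_prop) fun _ => Real.abs_cos_le_one _

theorem abs_charMean_le (z : E d) : |charMean ρ z| ≤ 1 := by
  have := norm_integral_le_of_norm_le_const (μ := ρ) (C := 1)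
    (f := fun ω => Real.cos (inner ℝ ω z))
    (Filter.Eventually.of_forall fun ω => Real.abs_cos_le_one _)
  simpa [charMean] using this

theorem abs_charMean_sub_le (hρ : Integrable (fun ω => ‖ω‖) ρ) (z z' : E d) :
    |charMean ρ z - charMean ρ z'| ≤ (∫ ω, ‖ω‖ ∂ρ) * ‖z - z'‖ := by
  rw [charMean, charMean, ← integral_sub (integrable_cos_inner z) (integrable_cos_inner z'),
    ← integral_mul_const, ← Real.norm_eq_abs]
  refine norm_integral_le_of_norm_le (hρ.mul_const _) (Filter.Eventually.of_forall fun ω => ?_)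
  exact (Real.abs_cos_sub_cos_le _ _).trans (by
    rw [← inner_sub_right]; exact abs_real_inner_le_norm _ _)

theorem continuous_charMean : Continuous (charMean ρ) := by
  have : charMean ρ = fun z => (charFun ρ z).re := by ext z; rw [re_charFun, charMean]
  rw [this]
  exact Complex.continuous_re.comp continuous_charFun

theorem measurable_kernelError :
    Measurable fun q : ((Fin s → E d) × (Fin s → E d)) × E d => kernelError a b ρ ρ' q.2 q.1 := by
  have h1 := (continuous_charMean (ρ := ρ)).measurable
  have h2 := (continuous_charMean (ρ := ρ')).measurable
  unfold kernelError charError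
  fun_prop

theorem abs_sub_mul_div_le (hs : 0 < s) (ha : 0 ≤ a) (ha1 : a ≤ 1) (hb : 0 ≤ b) (hb1 : b ≤ 1)
    {A B α β : ℝ} (hA : |A| ≤ s * α) (hB : |B| ≤ s * β) : |(b * B - a * A) / s| ≤ α + β := by
  have hs' : (0 : ℝ) < s := by exact_mod_cast hs
  rw [abs_div, abs_of_pos hs', div_le_iff₀ hs']
  refine (abs_sub _ _).trans ?_
  rw [abs_mul, abs_mul, abs_of_nonneg ha, abs_of_nonneg hb]
  have h1 := mul_le_of_le_one_left (abs_nonneg A) ha1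
  have h2 := mul_le_of_le_one_left (abs_nonneg B) hb1
  linarith

theorem abs_kernelError_le (hs : 0 < s) (ha : 0 ≤ a) (ha1 : a ≤ 1) (hb : 0 ≤ b) (hb1 : b ≤ 1)
    (z : E d) (p : (Fin s → E d) × (Fin s → E d)) : |kernelError a b ρ ρ' z p| ≤ 4 := by
  have h : ∀ (ρ : Measure (E d)) [IsProbabilityMeasure ρ] (ω : Fin s → E d),
      |charError (charMean ρ z) z ω| ≤ s * 2 := fun ρ _ ω =>
    (abs_charError_le _ z ω).trans
      (mul_le_mul_of_nonneg_left (by linarith [abs_charMean_le (ρ := ρ) z]) (Nat.cast_nonneg s))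
  exact (abs_sub_mul_div_le hs ha ha1 hb hb1 (h ρ p.1) (h ρ' p.2)).trans (by norm_num)

/-- The Lipschitz constant of the error. -/
def lipConst (ρ ρ' : Measure (E d)) (p : (Fin s → E d) × (Fin s → E d)) : ℝ :=
  ((∑ i, ‖p.1 i‖) / s + ∫ ω, ‖ω‖ ∂ρ) + ((∑ i, ‖p.2 i‖) / s + ∫ ω, ‖ω‖ ∂ρ')

theorem abs_charError_sub_le (hs : 0 < s) (hρ : Integrable (fun ω => ‖ω‖) ρ) (z z' : E d)
    (ω : Fin s → E d) : |charError (charMean ρ z) z ω - charError (charMean ρ z') z' ω| ≤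
      s * (((∑ i, ‖ω i‖) / s + ∫ ω, ‖ω‖ ∂ρ) * ‖z - z'‖) := by
  have hs' : (s : ℝ) ≠ 0 := by positivity
  have h1 : ∀ i, |(Real.cos (inner ℝ (ω i) z) - charMean ρ z) -
      (Real.cos (inner ℝ (ω i) z') - charMean ρ z')| ≤ (‖ω i‖ + ∫ ω, ‖ω‖ ∂ρ) * ‖z - z'‖ := by
    intro i
    rw [sub_sub_sub_comm]
    refine (abs_sub _ _).trans ?_
    rw [add_mul]
    refine add_le_add ((Real.abs_cos_sub_cos_le _ _).trans ?_) (abs_charMean_sub_le hρ z z')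
    rw [← inner_sub_right]
    exact abs_real_inner_le_norm _ _
  rw [charError, charError, ← Finset.sum_sub_distrib]
  refine (Finset.abs_sum_le_sum_abs _ _).trans ((Finset.sum_le_sum fun i _ => h1 i).trans_eq ?_)
  rw [← Finset.sum_mul, Finset.sum_add_distrib]
  simp
  field_simp

theorem abs_kernelError_sub_le (hs : 0 < s) (ha : 0 ≤ a) (ha1 : a ≤ 1) (hb : 0 ≤ b) (hb1 : b ≤ 1)
    (hρ : Integrable (fun ω => ‖ω‖) ρ) (hρ' : Integrable (fun ω => ‖ω‖) ρ') (z z' : E d)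
    (p : (Fin s → E d) × (Fin s → E d)) :
    |kernelError a b ρ ρ' z p - kernelError a b ρ ρ' z' p| ≤ lipConst ρ ρ' p * ‖z - z'‖ := by
  have := abs_sub_mul_div_le hs ha ha1 hb hb1 (abs_charError_sub_le hs hρ z z' p.1)
    (abs_charError_sub_le hs hρ' z z' p.2)
  rw [lipConst, add_mul]
  refine le_of_eq_of_le ?_ this
  rw [kernelError, kernelError, ← sub_div]
  congr 2
  ring

/-- The truncated quadratic that dominates `(1 - cos) / 2` on the ball of radius `2 R`. -/
def truncSq (R : ℝ) (ω : E d) : ℝ := min 1 (R ^ 2 * ‖ω‖ ^ 2)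

theorem truncSq_nonneg (R : ℝ) (ω : E d) : 0 ≤ truncSq R ω := le_min zero_le_one (by positivity)

theorem truncSq_le_one (R : ℝ) (ω : E d) : truncSq R ω ≤ 1 := min_le_left _ _

theorem measurable_truncSq (R : ℝ) : Measurable (truncSq R : E d → ℝ) := by
  unfold truncSq
  fun_prop

theorem integrable_truncSq (R : ℝ) : Integrable (truncSq R) ρ :=
  integrable_of_abs_le (C := 1) (measurable_truncSq R) fun ω => by
    rw [abs_of_nonneg (truncSq_nonneg R ω)]; exact truncSq_le_one R ω

theorem one_sub_cos_inner_le {R : ℝ} {z : E d} (hz : ‖z‖ ≤ 2 * R) (ω : E d) :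
    1 - Real.cos (inner ℝ ω z) ≤ 2 * truncSq R ω := by
  rw [truncSq, mul_min_of_nonneg _ _ zero_le_two]
  refine le_min (by linarith [Real.neg_one_le_cos (inner ℝ ω z)]) ?_
  have h1 := Real.one_sub_sq_div_two_le_cos (x := inner ℝ ω z)
  have h2 : (inner ℝ ω z : ℝ) ^ 2 ≤ (‖ω‖ * (2 * R)) ^ 2 := by
    rw [sq_le_sq]
    refine (abs_real_inner_le_norm _ _).trans ((mul_le_mul_of_nonneg_left hz (norm_nonneg _)).trans
      (le_abs_self _))
  nlinarith

/-- The error is a difference of two nonnegative quantities, the mean and the sum of `1 - cos`, each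
dominated by the truncated quadratic. The bound no longer depends on `z`, so no covering is needed.
-/
theorem abs_charError_le_truncSq {R : ℝ} {z : E d} (hz : ‖z‖ ≤ 2 * R) (ω : Fin s → E d) :
    |charError (charMean ρ z) z ω| ≤ 2 * ∑ i, truncSq R (ω i) + 2 * s * ∫ ω, truncSq R ω ∂ρ := by
  have h1 : 1 - charMean ρ z ≤ 2 * ∫ ω, truncSq R ω ∂ρ := by
    have := integral_mono ((integrable_const 1).sub (integrable_cos_inner (ρ := ρ) z))
      ((integrable_truncSq R).const_mul 2) (one_sub_cos_inner_le hz)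
    simp only [Pi.sub_apply] at this
    rw [integral_sub (integrable_const 1) (integrable_cos_inner (ρ := ρ) z),
      integral_const_mul, integral_const, probReal_univ, one_smul] at this
    exact this
  have h2 : 0 ≤ 1 - charMean ρ z := by linarith [(abs_le.1 (abs_charMean_le (ρ := ρ) z)).2]
  have h3 : charError (charMean ρ z) z ω =
      s * (1 - charMean ρ z) - ∑ i, (1 - Real.cos (inner ℝ (ω i) z)) := by
    simp [charError, Finset.sum_sub_distrib]; ring
  have h4 : ∑ i, (1 - Real.cos (inner ℝ (ω i) z)) ≤ 2 * ∑ i, truncSq R (ω i) := by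
    rw [Finset.mul_sum]
    exact Finset.sum_le_sum fun i _ => one_sub_cos_inner_le hz _
  have h5 : 0 ≤ ∑ i, (1 - Real.cos (inner ℝ (ω i) z)) :=
    Finset.sum_nonneg fun i _ => by linarith [Real.cos_le_one (inner ℝ (ω i) z)]
  have h6 := mul_le_mul_of_nonneg_left h1 (Nat.cast_nonneg (α := ℝ) s)
  have h7 := mul_nonneg (Nat.cast_nonneg (α := ℝ) s) h2
  rw [h3, abs_le]
  constructor <;> linarith

theorem abs_kernelError_le_truncSq (hs : 0 < s) (ha : 0 ≤ a) (ha1 : a ≤ 1) (hb : 0 ≤ b)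
    (hb1 : b ≤ 1) {R : ℝ} {z : E d} (hz : ‖z‖ ≤ 2 * R) (p : (Fin s → E d) × (Fin s → E d)) :
    |kernelError a b ρ ρ' z p| ≤ 2 / s * (∑ i, truncSq R (p.1 i) + ∑ i, truncSq R (p.2 i)) +
      2 * ((∫ ω, truncSq R ω ∂ρ) + ∫ ω, truncSq R ω ∂ρ') := by
  have hs' : (s : ℝ) ≠ 0 := by positivity
  have e : ∀ (ρ : Measure (E d)) (ω : Fin s → E d), 2 * ∑ i, truncSq R (ω i) +
      2 * s * ∫ ω, truncSq R ω ∂ρ =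
      s * (2 / s * ∑ i, truncSq R (ω i) + 2 * ∫ ω, truncSq R ω ∂ρ) := fun ρ ω => by
    field_simp
  have h1 := abs_charError_le_truncSq (ρ := ρ) hz p.1
  have h2 := abs_charError_le_truncSq (ρ := ρ') hz p.2
  rw [e] at h1 h2
  refine (abs_sub_mul_div_le hs ha ha1 hb hb1 h1 h2).trans_eq ?_
  ring

end Pointwise

/-! ### Concentration and moment inequalities -/

section Probability

variable {d s : ℕ} {ρ ρ' : Measure (E d)} [IsProbabilityMeasure ρ] [IsProbabilityMeasure ρ']
  {a b : ℝ}

open ProbabilityTheory in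
-- Each weighted cosine lies in `[-1, 1]`, so Hoeffding's lemma gives variance proxy `1`;
-- independence adds the proxies.
theorem hasSubgaussianMGF_charError (ha : 0 ≤ a) (ha1 : a ≤ 1) (z : E d) :
    HasSubgaussianMGF (fun ω => a * charError (charMean ρ z) z ω) s (mcLaw s ρ) := by
  have h1 : ∀ i : Fin s, HasSubgaussianMGF
      (fun ω : Fin s → E d => a * Real.cos (inner ℝ (ω i) z) - a * charMean ρ z) 1 (mcLaw s ρ) := by
    intro i
    have h := hasSubgaussianMGF_of_mem_Icc (μ := mcLaw s ρ) (a := -1) (b := 1)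
      (X := fun ω : Fin s → E d => a * Real.cos (inner ℝ (ω i) z))
      (Measurable.aemeasurable (by fun_prop)) (Filter.Eventually.of_forall fun ω => by
        rw [Set.mem_Icc, ← abs_le, abs_mul, abs_of_nonneg ha]
        exact mul_le_one₀ ha1 (abs_nonneg _) (Real.abs_cos_le_one _))
    rw [integral_const_mul, integral_mcLaw_cos] at h
    convert! h using 1
    rw [sub_neg_eq_add, one_add_one_eq_two]
    ext
    simp
  have h2 : iIndepFun (fun (i : Fin s) (ω : Fin s → E d) =>
      a * Real.cos (inner ℝ (ω i) z) - a * charMean ρ z) (mcLaw s ρ) :=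
    iIndepFun_pi (X := fun _ (ω : E d) => a * Real.cos (inner ℝ ω z) - a * charMean ρ z)
      fun _ => Measurable.aemeasurable (by fun_prop)
  have h3 := HasSubgaussianMGF.sum_of_iIndepFun h2 (s := Finset.univ) fun i _ => h1 i
  simp only [← mul_sub, ← Finset.mul_sum, Finset.sum_const, Finset.card_univ, Fintype.card_fin,
    nsmul_eq_mul, mul_one] at h3
  exact h3

open ProbabilityTheory in
theorem hasSubgaussianMGF_kernelError (ha : 0 ≤ a) (ha1 : a ≤ 1) (hb : 0 ≤ b) (hb1 : b ≤ 1)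
    (z : E d) : HasSubgaussianMGF (fun p => b * charError (charMean ρ' z) z p.2 -
      a * charError (charMean ρ z) z p.1) (s + s) ((mcLaw s ρ).prod (mcLaw s ρ')) := by
  have h1 := hasSubgaussianMGF_charError (s := s) (ρ := ρ) ha ha1 z
  have h2 := hasSubgaussianMGF_charError (s := s) (ρ := ρ') hb hb1 z
  have e1 : ((mcLaw s ρ).prod (mcLaw s ρ')).map Prod.fst = mcLaw s ρ :=
    measurePreserving_fst.map_eq
  have e2 : ((mcLaw s ρ).prod (mcLaw s ρ')).map Prod.snd = mcLaw s ρ' :=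
    measurePreserving_snd.map_eq
  rw [← e1] at h1
  rw [← e2] at h2
  have h1' := HasSubgaussianMGF.of_map (Y := Prod.fst) measurable_fst.aemeasurable h1
  have h2' := HasSubgaussianMGF.of_map (Y := Prod.snd) measurable_snd.aemeasurable h2
  exact h2'.sub_of_indepFun h1'
    (indepFun_prod ((measurable_charError (charMean ρ z) z).const_mul a)
      ((measurable_charError (charMean ρ' z) z).const_mul b)).symm

/-- Hoeffding's inequality for the kernel error at a single point. -/
theorem measureReal_abs_kernelError_ge_le (hs : 0 < s) (ha : 0 ≤ a) (ha1 : a ≤ 1) (hb : 0 ≤ b)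
    (hb1 : b ≤ 1) {t : ℝ} (ht : 0 ≤ t) (z : E d) :
    ((mcLaw s ρ).prod (mcLaw s ρ')).real {p | t ≤ |kernelError a b ρ ρ' z p|} ≤
      2 * Real.exp (-(s * t ^ 2 / 4)) := by
  have hs' : (0 : ℝ) < s := by exact_mod_cast hs
  have h := hasSubgaussianMGF_kernelError (s := s) (ρ := ρ) (ρ' := ρ') ha ha1 hb hb1 z
  have hst : 0 ≤ s * t := by positivity
  have h1 := h.measure_ge_le hst
  have h2 := h.neg.measure_ge_le hst
  have e : -(s * t) ^ 2 / (2 * ((s + s : NNReal) : ℝ)) = -(s * t ^ 2 / 4) := by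
    push_cast
    field_simp
    ring
  rw [e] at h1 h2
  rw [two_mul]
  refine le_trans ?_ (add_le_add h1 h2)
  refine le_trans (measureReal_mono ?_) (measureReal_union_le _ _)
  intro p hp
  simp only [Set.mem_ofPred_eq, kernelError, abs_div, abs_of_pos hs', le_div_iff₀ hs'] at hp
  rw [mul_comm, le_abs] at hp
  exact hp

/-- Markov's inequality for the Lipschitz constant. -/
theorem measureReal_lipConst_ge_le (hs : 0 < s) (hρ : Integrable (fun ω => ‖ω‖ ^ 2) ρ)
    (hρ' : Integrable (fun ω => ‖ω‖ ^ 2) ρ') {t : ℝ} (ht : 0 < t) :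
    ((mcLaw s ρ).prod (mcLaw s ρ')).real {p | t ≤ lipConst ρ ρ' p} ≤
      8 * ((∫ ω, ‖ω‖ ^ 2 ∂ρ) + ∫ ω, ‖ω‖ ^ 2 ∂ρ') / t ^ 2 := by
  have hs' : (0 : ℝ) < s := by exact_mod_cast hs
  have hmean : ∀ (ρ : Measure (E d)) [IsProbabilityMeasure ρ], Integrable (fun ω => ‖ω‖ ^ 2) ρ →
      (∫ ω, ‖ω‖ ∂ρ) ^ 2 ≤ ∫ ω, ‖ω‖ ^ 2 ∂ρ := by
    intro ρ _ h
    have hm : MemLp (fun ω : E d => ‖ω‖) 2 ρ :=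
      (memLp_two_iff_integrable_sq measurable_norm.aestronglyMeasurable).2 h
    have := ProbabilityTheory.variance_nonneg (fun ω : E d => ‖ω‖) ρ
    rw [ProbabilityTheory.variance_eq_sub hm] at this
    simpa using this
  have hsum : ∀ (ρ : Measure (E d)) [IsProbabilityMeasure ρ], Integrable (fun ω => ‖ω‖ ^ 2) ρ →
      Integrable (fun ω : Fin s → E d => ∑ i, ‖ω i‖ ^ 2) (mcLaw s ρ) ∧
      ∫ ω : Fin s → E d, ∑ i, ‖ω i‖ ^ 2 ∂(mcLaw s ρ) = s * ∫ ω, ‖ω‖ ^ 2 ∂ρ := by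
    intro ρ _ h
    have hi : ∀ i, Integrable (fun ω : Fin s → E d => ‖ω i‖ ^ 2) (mcLaw s ρ) := fun i =>
      integrable_comp_eval (μ := fun _ : Fin s => ρ) (f := fun ω : E d => ‖ω‖ ^ 2) h
    refine ⟨integrable_finsetSum _ fun i _ => hi i, ?_⟩
    rw [integral_finsetSum _ fun i _ => hi i]
    have : ∀ i : Fin s, ∫ ω : Fin s → E d, ‖ω i‖ ^ 2 ∂(mcLaw s ρ) = ∫ ω, ‖ω‖ ^ 2 ∂ρ := fun i =>
      integral_comp_eval (μ := fun _ : Fin s => ρ) (f := fun ω : E d => ‖ω‖ ^ 2)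
        h.aestronglyMeasurable
    simp [this]
  have hsq : ∀ ω : Fin s → E d, ((∑ i, ‖ω i‖) / s) ^ 2 ≤ (∑ i, ‖ω i‖ ^ 2) / s := by
    intro ω
    have := sq_sum_le_card_mul_sum_sq (s := Finset.univ) (f := fun i => ‖ω i‖)
    rw [Finset.card_univ, Fintype.card_fin] at this
    rw [div_pow, div_le_div_iff₀ (by positivity) hs']
    nlinarith
  obtain ⟨hi1, he1⟩ := hsum ρ hρ
  obtain ⟨hi2, he2⟩ := hsum ρ' hρ'
  have hi1' := hi1.comp_fst (mcLaw s ρ')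
  have hi2' := hi2.comp_snd (mcLaw s ρ)
  set v := (∫ ω, ‖ω‖ ^ 2 ∂ρ) + ∫ ω, ‖ω‖ ^ 2 ∂ρ'
  have hv : 0 ≤ v := add_nonneg (integral_nonneg fun _ => by positivity)
    (integral_nonneg fun _ => by positivity)
  have hG : Integrable (fun p : (Fin s → E d) × (Fin s → E d) =>
      ∑ i, ‖p.1 i‖ ^ 2 + ∑ i, ‖p.2 i‖ ^ 2) ((mcLaw s ρ).prod (mcLaw s ρ')) := hi1'.add hi2'
  have hG' : Integrable (fun p : (Fin s → E d) × (Fin s → E d) =>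
      4 / s * (∑ i, ‖p.1 i‖ ^ 2 + ∑ i, ‖p.2 i‖ ^ 2) + 4 * v) ((mcLaw s ρ).prod (mcLaw s ρ')) :=
    (hG.const_mul _).add (integrable_const _)
  have hGint : ∫ p : (Fin s → E d) × (Fin s → E d),
      (4 / s * (∑ i, ‖p.1 i‖ ^ 2 + ∑ i, ‖p.2 i‖ ^ 2) + 4 * v) ∂((mcLaw s ρ).prod (mcLaw s ρ')) =
      8 * v := by
    rw [integral_add (hG.const_mul _) (integrable_const _), integral_const_mul,
      integral_add hi1' hi2', integral_fun_fst (fun ω : Fin s → E d => ∑ i, ‖ω i‖ ^ 2),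
      integral_fun_snd (fun ω : Fin s → E d => ∑ i, ‖ω i‖ ^ 2), he1, he2]
    simp only [integral_const, probReal_univ, one_smul]
    rw [← mul_add]
    field_simp
    ring
  have hmarkov := mul_meas_ge_le_integral_of_nonneg (μ := (mcLaw s ρ).prod (mcLaw s ρ'))
    (Filter.Eventually.of_forall fun p => by positivity) hG' (t ^ 2)
  rw [hGint] at hmarkov
  rw [le_div_iff₀ (by positivity), mul_comm]
  refine le_trans (mul_le_mul_of_nonneg_left (measureReal_mono ?_) (sq_nonneg t)) hmarkov
  intro p hp
  simp only [Set.mem_ofPred_eq] at hp ⊢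
  have h1 := hsq p.1
  have h2 := hsq p.2
  have h3 := hmean ρ hρ
  have h4 := hmean ρ' hρ'
  have h5 : t ^ 2 ≤ lipConst ρ ρ' p ^ 2 := pow_le_pow_left₀ ht.le hp 2
  refine h5.trans ?_
  rw [lipConst]
  have e : 4 / s * (∑ i, ‖p.1 i‖ ^ 2 + ∑ i, ‖p.2 i‖ ^ 2) + 4 * v =
    4 * ((∑ i, ‖p.1 i‖ ^ 2) / s + (∑ i, ‖p.2 i‖ ^ 2) / s + v) := by ring
  rw [e]
  set A := (∑ i, ‖p.1 i‖) / (s : ℝ)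
  set B := (∑ i, ‖p.2 i‖) / (s : ℝ)
  set M := ∫ ω, ‖ω‖ ∂ρ
  set N := ∫ ω, ‖ω‖ ∂ρ'
  -- The empirical and the true mean lengths each contribute `v` in expectation, whence `4 * (v + v)
  -- = 8 v`.
  have h6 : (A + M + (B + N)) ^ 2 ≤ 4 * (A ^ 2 + B ^ 2 + (M ^ 2 + N ^ 2)) := by
    nlinarith [sq_nonneg (A - M), sq_nonneg (A - B), sq_nonneg (A - N), sq_nonneg (M - B),
      sq_nonneg (M - N), sq_nonneg (B - N)]
  linarith

/-- By convexity `exp` lies below its chord on `[0, 1]`, whose slope `e - 1` is below `7 / 4`. -/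
theorem exp_le_one_add_mul {x : ℝ} (h0 : 0 ≤ x) (h1 : x ≤ 1) : Real.exp x ≤ 1 + 7 / 4 * x := by
  have h := convexOn_exp.2 (Set.mem_univ (0 : ℝ)) (Set.mem_univ (1 : ℝ)) (sub_nonneg.2 h1) h0
    (by ring)
  simp only [smul_eq_mul, mul_zero, mul_one, zero_add, Real.exp_zero] at h
  nlinarith [Real.exp_one_lt_d9]

theorem integral_exp_truncSq_le (R : ℝ) :
    ∫ ω, Real.exp (truncSq R ω) ∂ρ ≤ Real.exp (7 / 4 * ∫ ω, truncSq R ω ∂ρ) := by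
  have hm := measurable_truncSq (d := d) R
  have hi : Integrable (fun ω => Real.exp (truncSq R ω)) ρ :=
    integrable_of_abs_le (C := Real.exp 1) (by fun_prop) fun ω => by
      rw [Real.abs_exp]; exact Real.exp_le_exp.2 (truncSq_le_one R ω)
  have h := integral_mono hi ((integrable_const 1).add ((integrable_truncSq R).const_mul (7 / 4)))
    fun ω => exp_le_one_add_mul (truncSq_nonneg R ω) (truncSq_le_one R ω)
  simp only [Pi.add_apply] at h
  rw [integral_add (integrable_const 1) ((integrable_truncSq R).const_mul (7 / 4)),
    integral_const_mul] at h
  simp only [integral_const, probReal_univ, one_smul] at h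
  exact h.trans (by linarith [Real.add_one_le_exp (7 / 4 * ∫ ω, truncSq R ω ∂ρ)])

theorem integral_exp_sum_truncSq_le (R : ℝ) :
    ∫ ω : Fin s → E d, Real.exp (∑ i, truncSq R (ω i)) ∂(mcLaw s ρ) ≤
      Real.exp (s * (7 / 4 * ∫ ω, truncSq R ω ∂ρ)) := by
  simp only [Real.exp_sum]
  rw [mcLaw, integral_fintype_prod_eq_pow (fun ω : E d => Real.exp (truncSq R ω)),
    Fintype.card_fin, Real.exp_nat_mul]
  exact pow_le_pow_left₀ (integral_nonneg fun _ => (Real.exp_pos _).le)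
    (integral_exp_truncSq_le R) s

/-- An exponential Markov inequality for the truncated quadratic. -/
theorem measureReal_sum_truncSq_ge_le (R : ℝ) {w : ℝ} (hw : 0 < w) :
    ((mcLaw s ρ).prod (mcLaw s ρ')).real
      {p | w ≤ ∑ i, truncSq R (p.1 i) + ∑ i, truncSq R (p.2 i)} ≤
      (Real.exp (s * (7 / 4 * ((∫ ω, truncSq R ω ∂ρ) + ∫ ω, truncSq R ω ∂ρ'))) - 1) /
        (Real.exp w - 1) := by
  have hm := measurable_truncSq (d := d) R
  have hi : ∀ (ρ : Measure (E d)) [IsProbabilityMeasure ρ],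
      Integrable (fun ω : Fin s → E d => Real.exp (∑ i, truncSq R (ω i))) (mcLaw s ρ) := fun ρ _ =>
    integrable_of_abs_le (C := Real.exp s) (by fun_prop) fun ω => by
      rw [Real.abs_exp]
      refine Real.exp_le_exp.2 ((Finset.sum_le_card_nsmul _ _ 1
        fun i _ => truncSq_le_one R (ω i)).trans_eq (by simp))
  have hprod := (hi ρ).mul_prod (hi ρ')
  have hw' : 0 < Real.exp w - 1 := by linarith [Real.add_one_lt_exp hw.ne']
  have hS0 : ∀ p : (Fin s → E d) × (Fin s → E d),
      0 ≤ ∑ i, truncSq R (p.1 i) + ∑ i, truncSq R (p.2 i) := fun p =>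
    add_nonneg (Finset.sum_nonneg fun i _ => truncSq_nonneg _ _)
      (Finset.sum_nonneg fun i _ => truncSq_nonneg _ _)
  have hmul : ∀ p : (Fin s → E d) × (Fin s → E d), Real.exp (∑ i, truncSq R (p.1 i)) *
      Real.exp (∑ i, truncSq R (p.2 i)) =
      Real.exp (∑ i, truncSq R (p.1 i) + ∑ i, truncSq R (p.2 i)) := fun p => (Real.exp_add _ _).symm
  have hint : Integrable (fun p : (Fin s → E d) × (Fin s → E d) =>
      Real.exp (∑ i, truncSq R (p.1 i)) * Real.exp (∑ i, truncSq R (p.2 i)) - 1)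
      ((mcLaw s ρ).prod (mcLaw s ρ')) := hprod.sub (integrable_const 1)
  -- Markov for `exp S - 1` rather than `exp S`: the resulting bound vanishes with the mean of
  -- `truncSq`, as the factor `R²` in the theorem requires.
  have hmarkov := mul_meas_ge_le_integral_of_nonneg
    (Filter.Eventually.of_forall fun p => by
      rw [hmul, Pi.zero_apply, sub_nonneg]; exact Real.one_le_exp (hS0 p)) hint (Real.exp w - 1)
  rw [le_div_iff₀ hw', mul_comm]
  refine le_trans (mul_le_mul_of_nonneg_left (measureReal_mono ?_) hw'.le) (hmarkov.trans ?_)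
  · intro p hp
    simp only [Set.mem_ofPred_eq] at hp ⊢
    rw [hmul]
    exact sub_le_sub_right (Real.exp_le_exp.2 hp) 1
  · rw [integral_sub hprod (integrable_const 1),
      integral_prod_mul (fun ω : Fin s → E d => Real.exp (∑ i, truncSq R (ω i)))
        (fun ω : Fin s → E d => Real.exp (∑ i, truncSq R (ω i)))]
    simp only [integral_const, probReal_univ, one_smul]
    refine sub_le_sub_right ?_ 1
    rw [mul_add (7 / 4 : ℝ), mul_add (s : ℝ), Real.exp_add]
    exact mul_le_mul (integral_exp_sum_truncSq_le R) (integral_exp_sum_truncSq_le R)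
      (integral_nonneg fun _ => (Real.exp_pos _).le) (Real.exp_pos _).le

end Probability

end

/-! ### The uniform error bound -/

section


theorem not_ofReal_le_iSup {F : Type*} [SeminormedAddCommGroup F] {g : F → ℝ} {R ε ε' : ℝ}
    (hε : 0 < ε) (hε' : ε' < ε) (hg : ∀ z, ‖z‖ ≤ 2 * R → g z ≤ ε') :
    ¬ ENNReal.ofReal ε ≤ ⨆ x ∈ Metric.closedBall (0 : F) R, ⨆ x' ∈ Metric.closedBall (0 : F) R,
      ENNReal.ofReal (g (x - x')) := by
  rw [not_le]
  refine lt_of_le_of_lt ?_ ((ENNReal.ofReal_lt_ofReal_iff hε).2 hε')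
  refine iSup₂_le fun x hx => iSup₂_le fun x' hx' => ENNReal.ofReal_le_ofReal (hg _ ?_)
  rw [mem_closedBall_zero_iff] at hx hx'
  linarith [norm_sub_le x x']

section Uniform

variable {d s : ℕ} {ρ ρ' : Measure (E d)} [IsProbabilityMeasure ρ] [IsProbabilityMeasure ρ']
  {a b : ℝ}

/-- If the error is large on a whole ball of radius `r`, then the set where it is large has large
volume; on average this is unlikely. -/
theorem measureReal_exists_forall_ball_le (hs : 0 < s) (ha : 0 ≤ a) (ha1 : a ≤ 1) (hb : 0 ≤ b)
    (hb1 : b ≤ 1) {t r R : ℝ} (ht : 0 ≤ t) (hr : 0 < r) (hR : 0 ≤ R) :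
    ((mcLaw s ρ).prod (mcLaw s ρ')).real {p | ∃ z : E d, ‖z‖ ≤ 2 * R ∧
      ∀ z', dist z' z < r → t ≤ |kernelError a b ρ ρ' z' p|} ≤
      2 * Real.exp (-(s * t ^ 2 / 4)) * ((2 * R + r) / r) ^ d := by
  set μ := (mcLaw s ρ).prod (mcLaw s ρ')
  set V := volume (Metric.ball (0 : E d) r)
  have hV0 : V ≠ 0 := (Metric.measure_ball_pos volume _ hr).ne'
  have hVtop : V ≠ ∞ := measure_ball_lt_top.ne
  set ν := (volume : Measure (E d)).restrict (Metric.ball 0 (2 * R + r))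
  set S := {q : ((Fin s → E d) × (Fin s → E d)) × E d | t ≤ |kernelError a b ρ ρ' q.2 q.1|}
  have hS : MeasurableSet S :=
    measurableSet_le measurable_const (continuous_abs.measurable.comp measurable_kernelError)
  have hν : ν Set.univ = ENNReal.ofReal (((2 * R + r) / r) ^ d) * V := by
    have h := Measure.addHaar_ball_mul_of_pos (volume : Measure (E d)) 0
      (show 0 < (2 * R + r) / r by positivity) r
    rw [div_mul_cancel₀ _ hr.ne', finrank_euclideanSpace_fin] at h
    rw [Measure.restrict_apply_univ, h]
  -- By Tonelli this is the expected volume of the set of large errors. Markov with threshold `V`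
  -- then gives the factor `((2R + r) / r)^d`, a ratio of ball volumes.
  have h1 : (μ.prod ν) S ≤ ENNReal.ofReal (2 * Real.exp (-(s * t ^ 2 / 4))) * ν Set.univ := by
    rw [Measure.prod_apply_symm hS, ← lintegral_const]
    refine lintegral_mono fun z => ?_
    rw [← ofReal_measureReal]
    exact ENNReal.ofReal_le_ofReal
      (measureReal_abs_kernelError_ge_le hs ha ha1 hb hb1 ht z)
  rw [Measure.prod_apply hS] at h1
  have h2 := mul_meas_ge_le_lintegral (μ := μ) (measurable_measure_prodMk_left (ν := ν) hS) V
  have h3 : μ {p | ∃ z : E d, ‖z‖ ≤ 2 * R ∧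
      ∀ z', dist z' z < r → t ≤ |kernelError a b ρ ρ' z' p|} ≤
      μ {p | V ≤ ν (Prod.mk p ⁻¹' S)} := by
    refine measure_mono ?_
    rintro p ⟨z, hz, hp⟩
    have h4 : V = volume (Metric.ball z r) := (Measure.addHaar_ball_center volume z r).symm
    have h5 : Metric.ball z r ⊆ Metric.ball 0 (2 * R + r) :=
      Metric.ball_subset_ball' (by rw [dist_zero_right]; linarith)
    rw [Set.mem_ofPred_eq, h4, Measure.restrict_apply (measurable_prodMk_left hS)]
    exact measure_mono fun z' hz' => ⟨hp z' hz', h5 hz'⟩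
  have h6 : V * μ {p | ∃ z : E d, ‖z‖ ≤ 2 * R ∧
      ∀ z', dist z' z < r → t ≤ |kernelError a b ρ ρ' z' p|} ≤
      V * ENNReal.ofReal (2 * Real.exp (-(s * t ^ 2 / 4)) * ((2 * R + r) / r) ^ d) := by
    refine (mul_le_mul_right h3 V).trans (h2.trans (h1.trans_eq ?_))
    rw [hν, ENNReal.ofReal_mul (p := 2 * Real.exp (-(s * t ^ 2 / 4))) (by positivity), ← mul_assoc]
    exact mul_comm _ _
  rw [ENNReal.mul_le_mul_iff_right hV0 hVtop] at h6
  exact ENNReal.toReal_le_of_le_ofReal (by positivity) h6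

/-- The event that the uniform error on the ball of radius `R` is at least `ε`. -/
def uniformErrorEvent (s : ℕ) (a b : ℝ) (ρ ρ' : Measure (E d)) (R ε : ℝ) :
    Set ((Fin s → E d) × (Fin s → E d)) :=
  {p | ENNReal.ofReal ε ≤ ⨆ x ∈ Metric.closedBall (0 : E d) R,
    ⨆ x' ∈ Metric.closedBall (0 : E d) R, ENNReal.ofReal |kernelError a b ρ ρ' (x - x') p|}

theorem integral_truncSq_le (hρ : Integrable (fun ω => ‖ω‖ ^ 2) ρ) (R : ℝ) :
    ∫ ω, truncSq R ω ∂ρ ≤ R ^ 2 * ∫ ω, ‖ω‖ ^ 2 ∂ρ := by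
  rw [← integral_const_mul]
  exact integral_mono (integrable_truncSq R) (hρ.const_mul _) fun ω => min_le_right _ _

/-- Combine `exp v - 1 ≤ v exp v` with `exp w - 1 = 2 exp(w / 2) sinh(w / 2) ≥ w exp(w / 2)`. The
result is linear in `v` and still decays in `w`. -/
theorem exp_sub_one_div_exp_sub_one_le {v w : ℝ} (hv : 0 ≤ v) (hw : 0 < w) :
    (Real.exp v - 1) / (Real.exp w - 1) ≤ v / w * Real.exp (v - w / 2) := by
  have h1 : Real.exp v - 1 ≤ v * Real.exp v := by
    have := Real.add_one_le_exp (-v)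
    have h2 : Real.exp v * Real.exp (-v) = 1 := by rw [← Real.exp_add]; simp
    nlinarith [Real.exp_pos v]
  have h2 : w * Real.exp (w / 2) ≤ Real.exp w - 1 := by
    have h3 := Real.self_le_sinh_iff.2 (show 0 ≤ w / 2 by linarith)
    rw [Real.sinh_eq] at h3
    have h4 : Real.exp (w / 2) * Real.exp (-(w / 2)) = 1 := by rw [← Real.exp_add]; simp
    have h5 : Real.exp w = Real.exp (w / 2) * Real.exp (w / 2) := by rw [← Real.exp_add]; ring_nf
    rw [h5]
    nlinarith [Real.exp_pos (w / 2)]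
  have h6 : 0 < w * Real.exp (w / 2) := by positivity
  calc _ ≤ (v * Real.exp v) / (w * Real.exp (w / 2)) := div_le_div₀ (by positivity) h1 h6 h2
    _ = _ := by rw [Real.exp_sub]; field_simp

/-- The uniform bound for small radii. -/
theorem measureReal_uniformErrorEvent_le_of_small (hs : 0 < s) (ha : 0 ≤ a) (ha1 : a ≤ 1)
    (hb : 0 ≤ b) (hb1 : b ≤ 1) (hρ : Integrable (fun ω => ‖ω‖ ^ 2) ρ)
    (hρ' : Integrable (fun ω => ‖ω‖ ^ 2) ρ') {R ε X : ℝ} (hε : 0 < ε) (hε4 : ε ≤ 4)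
    (hX : R ^ 2 * ((∫ ω, ‖ω‖ ^ 2 ∂ρ) + ∫ ω, ‖ω‖ ^ 2 ∂ρ') = X * ε ^ 2) (hX0 : 0 ≤ X)
    (hX1 : X ≤ 1 / 64) :
    ((mcLaw s ρ).prod (mcLaw s ρ')).real (uniformErrorEvent s a b ρ ρ' R ε) ≤
      16 * X * Real.exp (-(s * ε / 16)) := by
  have hs' : (0 : ℝ) < s := by exact_mod_cast hs
  set M := (∫ ω, truncSq R ω ∂ρ) + ∫ ω, truncSq R ω ∂ρ' with hM
  have hM1 : M ≤ X * (4 * ε) := by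
    have h1 := integral_truncSq_le hρ R
    have h2 := integral_truncSq_le hρ' R
    have h3 : X * ε ^ 2 ≤ X * (4 * ε) := mul_le_mul_of_nonneg_left (by nlinarith) hX0
    linarith
  have hM2 : M ≤ ε / 16 := hM1.trans (by nlinarith)
  have hw : 0 < 7 * s * ε / 16 := by positivity
  -- Below this threshold the samples contribute less than `7ε/8` to the error, and the means at
  -- most `2M ≤ ε/8`.
  have hsub : uniformErrorEvent s a b ρ ρ' R ε ⊆
      {p | 7 * s * ε / 16 ≤ ∑ i, truncSq R (p.1 i) + ∑ i, truncSq R (p.2 i)} := by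
    intro p hp
    by_contra hcon
    rw [Set.mem_ofPred_eq, not_le] at hcon
    refine not_ofReal_le_iSup (g := fun z => |kernelError a b ρ ρ' z p|) hε ?_
      (fun z hz => abs_kernelError_le_truncSq hs ha ha1 hb hb1 hz p) hp
    have h1 : 2 / s * (∑ i, truncSq R (p.1 i) + ∑ i, truncSq R (p.2 i)) < 2 / s * (7 * s * ε / 16) :=
      mul_lt_mul_of_pos_left hcon (by positivity)
    have h2 : 2 / s * (7 * s * ε / 16) = 7 / 8 * ε := by field_simp; norm_num
    linarith
  refine (measureReal_mono hsub).trans ((measureReal_sum_truncSq_ge_le R hw).trans ?_)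
  have hV : (s : ℝ) * (7 / 4 * M) ≤ 7 * X * ε * s := by nlinarith
  have hV0 : 0 ≤ 7 * X * ε * s := by positivity
  have hden : 0 < Real.exp (7 * s * ε / 16) - 1 := by linarith [Real.add_one_lt_exp hw.ne']
  calc _ ≤ (Real.exp (7 * X * ε * s) - 1) / (Real.exp (7 * s * ε / 16) - 1) := by
        refine div_le_div_of_nonneg_right ?_ hden.le
        exact sub_le_sub_right (Real.exp_le_exp.2 hV) 1
    _ ≤ _ := exp_sub_one_div_exp_sub_one_le hV0 hw
    -- For `X ≤ 1/64` the exponent is at most `7sε/64 - 7sε/32 = -7sε/64`.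
    _ ≤ 16 * X * Real.exp (-(s * ε / 16)) := by
        have e : 7 * X * ε * s / (7 * s * ε / 16) = 16 * X := by field_simp
        rw [e]
        refine mul_le_mul_of_nonneg_left (Real.exp_le_exp.2 ?_) (by positivity)
        have : 0 ≤ s * ε * (1 / 64 - X) := mul_nonneg (by positivity) (by linarith)
        nlinarith

/-- The uniform bound from a net of mesh `r`. -/
theorem measureReal_uniformErrorEvent_le_add (hs : 0 < s) (ha : 0 ≤ a) (ha1 : a ≤ 1)
    (hb : 0 ≤ b) (hb1 : b ≤ 1) (hρ : Integrable (fun ω => ‖ω‖ ^ 2) ρ)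
    (hρ' : Integrable (fun ω => ‖ω‖ ^ 2) ρ') {R ε r : ℝ} (hε : 0 < ε) (hR : 0 ≤ R) (hr : 0 < r) :
    ((mcLaw s ρ).prod (mcLaw s ρ')).real (uniformErrorEvent s a b ρ ρ' R ε) ≤
      2 * Real.exp (-(s * (ε / 2) ^ 2 / 4)) * ((2 * R + r) / r) ^ d +
      8 * ((∫ ω, ‖ω‖ ^ 2 ∂ρ) + ∫ ω, ‖ω‖ ^ 2 ∂ρ') / (ε / (2 * r)) ^ 2 := by
  have hint : ∀ (ρ : Measure (E d)) [IsProbabilityMeasure ρ], Integrable (fun ω => ‖ω‖ ^ 2) ρ →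
      Integrable (fun ω => ‖ω‖) ρ := fun ρ _ h =>
    ((memLp_two_iff_integrable_sq measurable_norm.aestronglyMeasurable).2 h).integrable one_le_two
  refine le_trans ?_ (add_le_add
    (measureReal_exists_forall_ball_le (ρ := ρ) (ρ' := ρ') hs ha ha1 hb hb1 (half_pos hε).le hr hR)
    (measureReal_lipConst_ge_le hs hρ hρ' (by positivity)))
  refine (measureReal_mono ?_).trans (measureReal_union_le _ _)
  intro p hp
  by_cases hL : ε / (2 * r) ≤ lipConst ρ ρ' p
  · exact Or.inr hL
  · left
    rw [not_le, lt_div_iff₀ (by positivity)] at hL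
    by_contra hcon
    refine not_ofReal_le_iSup (g := fun z => |kernelError a b ρ ρ' z p|) hε
      (show ε / 2 + lipConst ρ ρ' p * r < ε by linarith) (fun z hz => ?_) hp
    -- An error above `ε / 2 + L r` at `z`, `L` the Lipschitz constant, stays above `ε / 2` on the
    -- ball of radius `r` around `z`.
    by_contra hz'
    refine hcon ⟨z, hz, fun z' hzz => ?_⟩
    have h1 := abs_kernelError_sub_le hs ha ha1 hb hb1 (hint ρ hρ) (hint ρ' hρ') z z' p
    have h0 : 0 ≤ lipConst ρ ρ' p :=
      add_nonneg (add_nonneg (by positivity) (integral_nonneg fun _ => norm_nonneg _))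
        (add_nonneg (by positivity) (integral_nonneg fun _ => norm_nonneg _))
    rw [dist_comm, dist_eq_norm] at hzz
    have h2 := mul_le_mul_of_nonneg_left hzz.le h0
    have h3 := abs_sub_abs_le_abs_sub (kernelError a b ρ ρ' z p) (kernelError a b ρ ρ' z' p)
    linarith

/-- Uniform approximation by plain Monte Carlo sampling. -/
theorem measureReal_uniformErrorEvent_le (hs : 0 < s) (ha : 0 ≤ a) (ha1 : a ≤ 1)
    (hb : 0 ≤ b) (hb1 : b ≤ 1) (hρ : Integrable (fun ω => ‖ω‖ ^ 2) ρ)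
    (hρ' : Integrable (fun ω => ‖ω‖ ^ 2) ρ') {R ε : ℝ} (hε : 0 < ε) (hR : 0 ≤ R) :
    ((mcLaw s ρ).prod (mcLaw s ρ')).real (uniformErrorEvent s a b ρ ρ' R ε) ≤
      66 * (2 * √((∫ ω, ‖ω‖ ^ 2 ∂ρ) + ∫ ω, ‖ω‖ ^ 2 ∂ρ') * R / ε) ^ 2 *
        Real.exp (-(s * ε ^ 2 / (32 * (d + 2)))) := by
  have hs' : (0 : ℝ) < s := by exact_mod_cast hs
  set v := (∫ ω, ‖ω‖ ^ 2 ∂ρ) + ∫ ω, ‖ω‖ ^ 2 ∂ρ' with hvdef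
  have hv : 0 ≤ v := add_nonneg (integral_nonneg fun _ => by positivity)
    (integral_nonneg fun _ => by positivity)
  obtain ⟨X, hX⟩ : ∃ X, X = v * R ^ 2 / ε ^ 2 := ⟨_, rfl⟩
  have hX0 : 0 ≤ X := by rw [hX]; positivity
  have hXε : R ^ 2 * v = X * ε ^ 2 := by rw [hX]; field_simp
  obtain ⟨t, ht⟩ : ∃ t : ℝ, t = s * ε ^ 2 / (32 * (d + 2)) := ⟨_, rfl⟩
  have ht0 : 0 ≤ t := by rw [ht]; positivity
  have e1 : 66 * (2 * √v * R / ε) ^ 2 = 264 * X := by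
    rw [div_pow, mul_pow, mul_pow, Real.sq_sqrt hv, hX]; ring
  rw [e1, ← ht]
  -- The error never exceeds `4`, so the event is empty for larger `ε`.
  rcases lt_or_ge 4 ε with hε4 | hε4
  · have : uniformErrorEvent s a b ρ ρ' R ε = ∅ := Set.eq_empty_of_forall_notMem fun p =>
      not_ofReal_le_iSup (g := fun z => |kernelError a b ρ ρ' z p|) hε hε4
        fun z _ => abs_kernelError_le hs ha ha1 hb hb1 z p
    rw [this, measureReal_empty]
    positivity
  rcases le_or_gt X (1 / 64) with hX1 | hX1
  · refine (measureReal_uniformErrorEvent_le_of_small hs ha ha1 hb hb1 hρ hρ' hε hε4 hXε hX0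
      hX1).trans ?_
    have h1 : t ≤ s * ε / 16 := by
      rw [ht, div_le_div_iff₀ (by positivity) (by norm_num)]
      have : 0 ≤ s * ε * (4 - ε) := mul_nonneg (by positivity) (by linarith)
      have : 0 ≤ (s : ℝ) * ε * d := by positivity
      nlinarith
    exact mul_le_mul (by linarith) (Real.exp_le_exp.2 (by linarith)) (Real.exp_pos _).le
      (by positivity)
  have hy0 := Real.exp_pos (-t)
  have hy1 : Real.exp (-t) ≤ 1 := Real.exp_le_one_iff.2 (by linarith)
  set y := Real.exp (-t) with hy
  -- For `X > 1/64` and `y ≥ 1/4` the claimed bound exceeds `264 / 256 > 1`, so it is trivial.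
  rcases le_or_gt (1 / 4) y with hy4 | hy4
  · exact measureReal_le_one.trans (by nlinarith)
  have hR0 : 0 < R := by
    rcases hR.eq_or_lt with h | h
    · rw [← h] at hX; norm_num at hX; linarith
    · exact h
  -- The radius `r = 4 R y` makes the Lipschitz term `512 X y²`. Hoeffding's factor is `y^(2(d+2))`,
  -- of which `y^d` absorbs the volume ratio, since `y (2R + r) / r = 1/2 + y ≤ 1`. With `y < 1/4`
  -- and `X > 1/64` the total is at most `128 X y + 32 X y ≤ 264 X y`.
  refine (measureReal_uniformErrorEvent_le_add hs ha ha1 hb hb1 hρ hρ' hε hR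
    (r := 4 * R * y) (by positivity)).trans ?_
  have e2 : 8 * v / (ε / (2 * (4 * R * y))) ^ 2 = 512 * X * y ^ 2 := by
    rw [hX]; field_simp; ring
  have e3 : Real.exp (-(s * (ε / 2) ^ 2 / 4)) = y ^ d * y ^ d * y ^ 4 := by
    rw [hy, ← pow_add, ← pow_add, ← Real.exp_nat_mul]
    congr 1
    rw [ht]
    push_cast
    field_simp
    ring
  have e4 : y ^ d * ((2 * R + 4 * R * y) / (4 * R * y)) ^ d ≤ 1 := by
    rw [← mul_pow]
    refine pow_le_one₀ (by positivity) ?_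
    have : y * ((2 * R + 4 * R * y) / (4 * R * y)) = 1 / 2 + y := by field_simp; ring
    rw [this]
    linarith
  have h5 : y ^ d * y ^ 4 ≤ y ^ 2 := by
    calc y ^ d * y ^ 4 ≤ 1 * y ^ 4 :=
          mul_le_mul_of_nonneg_right (pow_le_one₀ hy0.le hy1) (by positivity)
      _ ≤ y ^ 2 := by rw [one_mul]; exact pow_le_pow_of_le_one hy0.le hy1 (by norm_num)
  have h6 : 2 * (y ^ d * y ^ d * y ^ 4) * ((2 * R + 4 * R * y) / (4 * R * y)) ^ d ≤ 2 * y ^ 2 := by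
    calc _ = 2 * (y ^ d * y ^ 4) * (y ^ d * ((2 * R + 4 * R * y) / (4 * R * y)) ^ d) := by ring
      _ ≤ 2 * (y ^ d * y ^ 4) * 1 := mul_le_mul_of_nonneg_left e4 (by positivity)
      _ ≤ 2 * y ^ 2 := by linarith
  rw [e2, e3]
  have h7 : y ^ 2 ≤ y / 4 := by nlinarith
  have h8 : 512 * X * y ^ 2 ≤ 512 * X * (y / 4) := mul_le_mul_of_nonneg_left h7 (by positivity)
  have h9 : y / 64 ≤ X * y := by nlinarith
  nlinarith

end Uniform

theorem integrable_normalized {d : ℕ} {μ : Measure (E d)} {f : E d → ℝ}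
    (hμ : μ ≠ 0) (hf : Integrable f μ) : Integrable f (normalized μ) :=
  hf.smul_measure (ENNReal.inv_ne_top.2 (Measure.measure_univ_ne_zero.2 hμ))

end

end SignedRF

end

/-! ### The main theorem -/

open SignedRF in
theorem mainTheorem3 :
    -- (i) uniform approximation by plain Monte Carlo sampling
    (∀ (d s : ℕ) (k : E d → E d → ℝ) (c₁ c₂ : ℝ) (μp μm : Measure (E d))
      [IsFiniteMeasure μp] [IsFiniteMeasure μm],
      0 < s → 0 ≤ c₁ → 0 ≤ c₂ → μp ≠ 0 → μm ≠ 0 →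
      IsRepresentedBy k c₁ c₂ μp μm →
      -- the two positive definite parts of the kernel are normalized
      c₁ * μp.real Set.univ ≤ 1 → c₂ * μm.real Set.univ ≤ 1 →
      Integrable (fun ω => ‖ω‖ ^ 2) μp → Integrable (fun ν => ‖ν‖ ^ 2) μm →
      ∀ R ε : ℝ, 0 ≤ R → 0 < ε →
        ((mcLaw s (normalized μp)).prod (mcLaw s (normalized μm)))
          {p | ENNReal.ofReal ε ≤
            ⨆ x ∈ Metric.closedBall (0 : E d) R, ⨆ x' ∈ Metric.closedBall (0 : E d) R,
              ENNReal.ofReal ‖(k x x' : ℂ) - approxKernel (c₁ * μp.real Set.univ)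
                (c₂ * μm.real Set.univ) p.1 p.2 x x'‖}
        ≤ ENNReal.ofReal (66 * (2 * √(sigmaSq μp μm) * R / ε) ^ 2 *
            Real.exp (-(s * ε ^ 2 / (32 * (d + 2)))))) ∧
    -- (ii) variance reduction by orthogonal Monte Carlo sampling in high dimension, for radial
    -- kernels `k(x, x') = c₁ φ₊(‖x - x'‖) - c₂ φ₋(‖x - x'‖)`
    (∀ (φp φm : ℝ → ℝ) (c₁ c₂ : ℝ) (k : (d : ℕ) → E d → E d → ℝ) (μp μm : (d : ℕ) → Measure (E d))
      [∀ d, IsFiniteMeasure (μp d)] [∀ d, IsFiniteMeasure (μm d)],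
      0 ≤ c₁ → 0 ≤ c₂ → (∀ d, μp d ≠ 0) → (∀ d, μm d ≠ 0) →
      (∀ d, IsRepresentedBy (k d) c₁ c₂ (μp d) (μm d)) →
      (∀ (d : ℕ) (z : E d), charFun (μp d) z = φp ‖z‖) →
      (∀ (d : ℕ) (z : E d), charFun (μm d) z = φm ‖z‖) →
      ∀ r : ℝ, ∃ d₀ : ℕ, ∀ (d : ℕ) [NeZero d], d₀ ≤ d → ∀ s : ℕ, 0 < s →
        ∀ x x' : E d, ‖x - x'‖ = r →
          mse (k d) (c₁ * (μp d).real Set.univ) (c₂ * (μm d).real Set.univ)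
              (omcLaw s (normalized (μp d))) (omcLaw s (normalized (μm d))) x x'
            ≤ mse (k d) (c₁ * (μp d).real Set.univ) (c₂ * (μm d).real Set.univ)
              (mcLaw s (normalized (μp d))) (mcLaw s (normalized (μm d))) x x') := by
  refine ⟨?_, ?_⟩
  · intro d s k c₁ c₂ μp μm _ _ hs hc₁ hc₂ hp hm hk ha1 hb1 hip him R ε hR hε
    have := isProbabilityMeasure_normalized hp
    have := isProbabilityMeasure_normalized hm
    have ha : 0 ≤ c₁ * μp.real Set.univ := mul_nonneg hc₁ measureReal_nonneg
    have hb : 0 ≤ c₂ * μm.real Set.univ := mul_nonneg hc₂ measureReal_nonneg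
    have hnorm : ∀ (x x' : E d) (p : (Fin s → E d) × (Fin s → E d)),
        ‖(k x x' : ℂ) - approxKernel (c₁ * μp.real Set.univ) (c₂ * μm.real Set.univ) p.1 p.2 x x'‖ =
        |kernelError (c₁ * μp.real Set.univ) (c₂ * μm.real Set.univ) (normalized μp)
          (normalized μm) (x - x') p| := fun x x' p => by
      rw [kernel_sub_approxKernel_eq hs ha hb x x' (hk.eq_sub hp hm x x'), Complex.norm_real,
        Real.norm_eq_abs]
      rfl
    simp only [hnorm]
    have h := measureReal_uniformErrorEvent_le hs ha ha1 hb hb1 (integrable_normalized hp hip)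
      (integrable_normalized hm him) hε hR
    have h' := ENNReal.ofReal_le_ofReal h
    rw [ofReal_measureReal] at h'
    exact h'
  · intro φp φm c₁ c₂ k μp μm _ _ hc₁ hc₂ hp hm hk hφp hφm r
    exact exists_forall_mse_omcLaw_le hc₁ hc₂ hp hm hk hφp hφm r
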